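/- All graphs are finite and simple; let $G$ be a graph with vertex set $V$. **Perfect.** $G$ is *perfect* if for every induced subgraph the chromatic number equals the clique number. **$h$-perfect.** Let $\operatorname{STAB}(G)\subset\mathbb R^V$ be the convex hull of the vectors $v\in\{0,1\}^V$ with $v_iv_j=0$ whenever $i,j$ are adjacent. $G$ is *$h$-perfect* if every facet of $\operatorname{STAB}(G)$ is defined by one of the inequalities $x_i\ge 0$ with $i\in V$; $\sum_{i\in K}x_i\le 1$ with $K$ a clique of $G$; $\sum_{i\in C}x_i\le a$ with $C$ the vertex set of an odd cycle of $G$ of length $2a+1$, $a\ge 1$. **$\hbar$-perfect.** A Pauli string of length $m$ is a tensor product of $m$ matrices from $\{\mathbb 1,X,Y,Z\}$. A *realization* of $G$ is a family $S=(S_i)_{i\in V}$ of Pauli strings of one common length such that $S_i$ and $S_j$ anticommute if and only if $i$ and $j$ are adjacent; realizations always exist. For $w\in\mathbb R_{\ge 0}^V$ put $$\alpha(G,w)=\max_{I\subseteq V\text{ independent}}\ \sum_{i\in I}w_i,\qquad \beta(G,w)=\sup_{\rho}\ \sum_{i\in V}w_i\,(\operatorname{tr}\rho S_i)^2,$$ where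 $\rho$ ranges over all density matrices. Moreover, let $$\operatorname{BETA}(G)=\operatorname{conv}\Bigl\{x\in\mathbb R^V : \exists\rho\ \forall i\in V\;\; x_i\le(\operatorname{tr}\rho S_i)^2\Bigr\}\cap\mathbb R_{\ge 0}^V .$$ $G$ is *$\hbar$-perfect* if, in every realization of $G$, $\operatorname{STAB}(G)=\operatorname{BETA}(G)$ and (equivalently) $\beta(G,w)=\alpha(G,w)$ for all $w\in\mathbb R_{\ge 0}^V$. **Theorem.** Every perfect graph is $h$-perfect, and every $h$-perfect graph is $\hbar$-perfect: $$G\text{ perfect}\ \Rightarrow\ G\ h\text{-perfect}\ \Rightarrow\ G\ \hbar\text{-perfect}.$$ In addition, every odd cycle $C_{2a+1}$, $a\ge 1$, is $h$-perfect. -/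

import Mathlib

namespace HbarGraph

open scoped ComplexOrder

/-! ### Pauli strings, states and the beta body -/

/-- The labels of the four one-qubit Pauli matrices (`one` stands for the identity). -/
inductive PauliLabel : Type
  | one
  | X
  | Y
  | Z

/-- The one-qubit Pauli matrices. -/
def pauliMatrix : PauliLabel → Matrix (Fin 2) (Fin 2) ℂ
  | .one => !![1, 0; 0, 1]
  | .X => !![0, 1; 1, 0]
  | .Y => !![0, -Complex.I; Complex.I, 0]
  | .Z => !![1, 0; 0, -1]

/-- The Pauli string with letters `p 0, …, p (m - 1)`: the tensor product of the corresponding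
Pauli matrices, an operator on `m` qubits whose standard basis is indexed by `Fin m → Fin 2`. -/
def pauliString {m : ℕ} (p : Fin m → PauliLabel) : Matrix (Fin m → Fin 2) (Fin m → Fin 2) ℂ :=
  Matrix.of fun x y => ∏ k, pauliMatrix (p k) (x k) (y k)

/-- Density matrices. -/
def IsState {ι : Type*} [Fintype ι] (ρ : Matrix ι ι ℂ) : Prop :=
  ρ.PosSemidef ∧ ρ.trace = 1

/-- The expectation value `⟨A⟩_ρ` (it is real if `A` is Hermitian and `ρ` is a state). -/
noncomputable def expectation {ι : Type*} [Fintype ι] (A ρ : Matrix ι ι ℂ) : ℝ :=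
  (ρ * A).trace.re

section

variable {V : Type*}

/-- `G` is the frustration graph of the family `S` of Pauli strings: two vertices are adjacent
if and only if their strings anticommute. -/
def IsRealization (G : SimpleGraph V) {m : ℕ} (S : V → Fin m → PauliLabel) : Prop :=
  ∀ i j, G.Adj i j ↔
    pauliString (S i) * pauliString (S j) = -(pauliString (S j) * pauliString (S i))

/-- The weighted beta number, computed in the realization `S`. -/
noncomputable def betaNumber [Fintype V] {m : ℕ} (S : V → Fin m → PauliLabel) (w : V → ℝ) : ℝ :=
  sSup {r | ∃ ρ, IsState ρ ∧ r = ∑ i, w i * expectation (pauliString (S i)) ρ ^ 2}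

/-- The simultaneous variance range `𝒬(S)`. -/
def varianceRange {m : ℕ} (S : V → Fin m → PauliLabel) : Set (V → ℝ) :=
  {v | ∃ ρ, IsState ρ ∧ v = fun i => expectation (pauliString (S i)) ρ ^ 2}

/-- The beta body: the convex hull of the down-closure of the simultaneous variance range,
intersected with the nonnegative orthant. -/
def betaBody {m : ℕ} (S : V → Fin m → PauliLabel) : Set (V → ℝ) :=
  convexHull ℝ (lowerClosure (varianceRange S) : Set (V → ℝ)) ∩ {v | ∀ i, 0 ≤ v i}

/-! ### Independent sets and the stable set polytope -/

/-- The weighted independence number (a maximum over the finitely many independent sets). -/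
noncomputable def indepNumber (G : SimpleGraph V) (w : V → ℝ) : ℝ :=
  sSup {r | ∃ s : Finset V, G.IsIndepSet (s : Set V) ∧ r = ∑ i ∈ s, w i}

/-- The stable set polytope `STAB(G)`. -/
def stab (G : SimpleGraph V) : Set (V → ℝ) :=
  convexHull ℝ {v | (∀ i j, G.Adj i j → v i * v j = 0) ∧ ∀ i, v i = 0 ∨ v i = 1}

/-! ### Three notions of perfection -/

/-- A graph is perfect if the chromatic number and the clique number agree for all induced
subgraphs. -/
def IsPerfect (G : SimpleGraph V) : Prop :=
  ∀ s : Set V, (G.induce s).chromaticNumber = ((G.induce s).cliqueNum : ℕ∞)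

/-- `F` is a facet of the polytope `P`: a nonempty (exposed) face of dimension `dim P - 1`. -/
def IsFacet (P F : Set (V → ℝ)) : Prop :=
  IsExposed ℝ P F ∧ F.Nonempty ∧
    Module.finrank ℝ (vectorSpan ℝ F) + 1 = Module.finrank ℝ (vectorSpan ℝ P)

/-- `C` is the vertex set of a (not necessarily chordless) cycle of length `2a+1 ≥ 3` in `G`. -/
def IsOddCycle (G : SimpleGraph V) (a : ℕ) (C : Finset V) : Prop :=
  1 ≤ a ∧ ∃ f : (SimpleGraph.cycleGraph (2 * a + 1)).Copy G, Set.range f = (C : Set V)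

/-- A graph is `h`-perfect if every facet of `STAB(G)` is given by one of the inequalities
`x_i ≥ 0`, `∑_{i ∈ K} x_i ≤ 1` for a clique `K`, or `∑_{i ∈ C} x_i ≤ a` for an odd cycle `C`
with `2a+1` vertices. -/
def IsHPerfect (G : SimpleGraph V) : Prop :=
  ∀ F, IsFacet (stab G) F →
    (∃ i, F = {x ∈ stab G | x i = 0}) ∨
    (∃ K : Finset V, G.IsClique (K : Set V) ∧ F = {x ∈ stab G | ∑ i ∈ K, x i = 1}) ∨
    (∃ (a : ℕ) (C : Finset V), IsOddCycle G a C ∧ F = {x ∈ stab G | ∑ i ∈ C, x i = a})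

/-- A graph is `ħ`-perfect if `STAB(G) = BETA(G)` and, equivalently, `β(G,w) = α(G,w)` for all
`w ≥ 0`. Both forms are required, in every realization of `G` by Pauli strings; a realization
of a finite graph always exists, see `exists_isRealization`. -/
def IsHbarPerfect [Fintype V] (G : SimpleGraph V) : Prop :=
  ∀ (m : ℕ) (S : V → Fin m → PauliLabel), IsRealization G S →
    stab G = betaBody S ∧ ∀ w : V → ℝ, (∀ i, 0 ≤ w i) → betaNumber S w = indepNumber G w

end

/-! ### Every finite graph is a frustration graph -/

theorem pauliString_mul_apply {m : ℕ} (p q : Fin m → PauliLabel) (x y : Fin m → Fin 2) :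
    (pauliString p * pauliString q) x y =
      ∏ k, (pauliMatrix (p k) * pauliMatrix (q k)) (x k) (y k) := by
  simp only [pauliString, Matrix.mul_apply, Matrix.of_apply, ← Finset.prod_mul_distrib]
  rw [Finset.prod_univ_sum]
  simp

theorem pauliMatrix_mul_self (p : PauliLabel) : pauliMatrix p * pauliMatrix p = 1 := by
  cases p <;> ext i j <;> fin_cases i <;> fin_cases j <;> simp [pauliMatrix]

theorem pauliString_mul_self {m : ℕ} (p : Fin m → PauliLabel) :
    pauliString p * pauliString p = 1 := by
  ext x y
  rw [pauliString_mul_apply]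
  simp only [pauliMatrix_mul_self, Matrix.one_apply, funext_iff]
  by_cases h : ∀ k, x k = y k
  · simp [h]
  · obtain ⟨k, hk⟩ := not_forall.1 h
    rw [if_neg h]
    exact Finset.prod_eq_zero (Finset.mem_univ k) (by simp [hk])

theorem exists_isRealization {V : Type*} [Fintype V] (G : SimpleGraph V) :
    ∃ (m : ℕ) (S : V → Fin m → PauliLabel), IsRealization G S := by
  classical
  let e := Fintype.equivFin V
  let S : V → Fin (Fintype.card V) → PauliLabel := fun i k =>
    if k = e i then .X else if k < e i ∧ G.Adj (e.symm k) i then .Z else .one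
  have key : ∀ i j, e j < e i → pauliString (S i) * pauliString (S j) =
      (if G.Adj i j then (-1 : ℂ) else 1) • (pauliString (S j) * pauliString (S i)) := by
    intro i j hij
    have hk : ∀ k, pauliMatrix (S i k) * pauliMatrix (S j k) =
        (if k = e j then (if G.Adj i j then (-1 : ℂ) else 1) else 1) •
          (pauliMatrix (S j k) * pauliMatrix (S i k)) := by
      intro k
      by_cases hkj : k = e j
      · subst hkj
        by_cases ha : G.Adj i j
        · have hb := ha.symm
          simp only [S, hij.ne, hij, ha, hb, Equiv.symm_apply_apply, if_true, if_false, and_self]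
          ext a b
          fin_cases a <;> fin_cases b <;> simp [pauliMatrix]
        · have hb : ¬ G.Adj j i := fun h => ha h.symm
          simp only [S, hij.ne, ha, hb, Equiv.symm_apply_apply, if_true, if_false, and_false]
          ext a b
          fin_cases a <;> fin_cases b <;> simp [pauliMatrix]
      · simp only [hkj, if_false, one_smul]
        by_cases hki : k = e i
        · subst hki
          simp only [S, hkj, hij.not_gt, if_true, if_false, false_and]
          ext a b
          fin_cases a <;> fin_cases b <;> simp [pauliMatrix]
        · simp only [S, hki, hkj, if_false]
          split_ifs <;> ext a b <;> fin_cases a <;> fin_cases b <;> simp [pauliMatrix]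
    ext x y
    rw [Matrix.smul_apply, pauliString_mul_apply, pauliString_mul_apply]
    simp only [hk, Matrix.smul_apply, smul_eq_mul, Finset.prod_mul_distrib]
    congr 1
    simp
  have ne : ∀ i j, pauliString (S i) * pauliString (S j) ≠
      -(pauliString (S i) * pauliString (S j)) := by
    intro i j h
    have h0 : pauliString (S i) * pauliString (S j) = 0 := by
      ext x y
      have hxy := congrFun (congrFun h x) y
      rw [Matrix.neg_apply] at hxy
      exact self_eq_neg.1 hxy
    have h1 : pauliString (S i) * (pauliString (S i) * pauliString (S j)) * pauliString (S j)
        = 1 := by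
      rw [← mul_assoc, pauliString_mul_self, one_mul, pauliString_mul_self]
    rw [h0] at h1
    simp at h1
  refine ⟨_, S, fun i j => ?_⟩
  rcases lt_trichotomy (e j) (e i) with h | h | h
  · have := key i j h
    by_cases ha : G.Adj i j
    · simp only [ha, if_true] at this
      simp [ha, this]
    · simp only [ha, if_false, one_smul] at this
      simp only [ha, false_iff, this]
      exact ne j i
  · have : j = i := e.injective h
    subst this
    simpa using ne j j
  · have := key j i h
    by_cases ha : G.Adj i j
    · have hb := ha.symm
      simp only [hb, if_true] at this
      simp [ha, this]
    · have hb : ¬ G.Adj j i := fun h => ha h.symm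
      simp only [hb, if_false, one_smul] at this
      simp only [ha, false_iff, this]
      exact ne i j

end HbarGraph

/-!
A graph is `h`-perfect precisely when the polytope `hstab G` cut out by the nonnegativity, clique
and odd cycle inequalities lies in `stab G`. One direction holds because a facet of a polyhedron is
given by one of the inequalities describing it, the other because every point outside a
full-dimensional polytope violates a facet inequality, and inequalities defining the same facet are
violated together.

For perfect graphs and odd cycles, a point `x` of `hstab G` is the limit of the vectors
`⌊N x⌋ / N`, and each of these is an average of `N` stable sets because the integral weights
`⌊N x⌋` admit a multicoloring with `N` colors.

For `h`-perfect graphs, common eigenvectors of commuting strings give `stab G ⊆ betaBody S`.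
Conversely the vectors of squared expectations satisfy the inequalities defining `hstab G`. For a
clique this says that the variance of `∑ i, ⟨S i⟩ S i` is nonnegative. For an induced cycle of odd
length `n + 1`, the product `Z` of its strings commutes with all of them, so one may assume that
`Z` acts as a sign. Products of consecutive strings then have a Gram matrix `1 + K`, where `K` is
skew-symmetric, has the `⟨S k⟩`, up to phases, next to the diagonal, and has norm at most `1`. Its
size `n + 1` is odd, so `K` is singular, and comparing Frobenius norms yields
`2 ∑ k, ⟨S k⟩ ^ 2 ≤ n`. Odd cycles with chords reduce to induced ones.
-/

namespace HbarGraph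

open scoped ComplexOrder Matrix Pointwise Topology

/-! ### Polyhedra -/

section Polyhedra

variable {E : Type*} [AddCommGroup E] [Module ℝ E]

theorem le_of_mem_convexHull {s : Set E} {l : E →ₗ[ℝ] ℝ} {c : ℝ} (h : ∀ v ∈ s, l v ≤ c) {x : E}
    (hx : x ∈ convexHull ℝ s) : l x ≤ c :=
  convexHull_min h (convex_halfSpace_le l.isLinear c) hx

theorem vectorSpan_le_ker {s : Set E} {l : E →ₗ[ℝ] ℝ} {c : ℝ} (h : ∀ y ∈ s, l y = c) :
    vectorSpan ℝ s ≤ LinearMap.ker l := by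
  rw [vectorSpan_def, Submodule.span_le]
  rintro _ ⟨x, hx, y, hy, rfl⟩
  simp [h x hx, h y hy]

theorem exists_forall_apply_lt {ι : Type*} [Finite ι] {s : Set E} (hs : Convex ℝ s)
    (hne : s.Nonempty) {A : ι → E →ₗ[ℝ] ℝ} {b : ι → ℝ} (hle : ∀ i, ∀ y ∈ s, A i y ≤ b i)
    (hlt : ∀ i, ∃ y ∈ s, A i y < b i) : ∃ y ∈ s, ∀ i, A i y < b i := by
  classical
  cases nonempty_fintype ι
  suffices h : ∀ J : Finset ι, ∃ y ∈ s, ∀ i ∈ J, A i y < b i by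
    simpa using h Finset.univ
  intro J
  induction J using Finset.induction_on with
  | empty => exact hne.imp fun y hy => ⟨hy, by simp⟩
  | insert i J _ ih =>
    obtain ⟨y, hy, hyJ⟩ := ih
    obtain ⟨z, hz, hzi⟩ := hlt i
    refine ⟨(1 / 2 : ℝ) • y + (1 / 2 : ℝ) • z,
      hs hy hz (by norm_num) (by norm_num) (by norm_num), fun j hj => ?_⟩
    have hyj := hle j y hy
    have hzj := hle j z hz
    simp only [map_add, map_smul, smul_eq_mul]
    rcases Finset.mem_insert.1 hj with rfl | hj
    · linarith
    · linarith [hyJ j hj]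

theorem isExposed_setOf_apply_eq [TopologicalSpace E] {P : Set E} {l : StrongDual ℝ E} {c : ℝ}
    (h : ∀ y ∈ P, l y ≤ c) : IsExposed ℝ P {y ∈ P | l y = c} := by
  rintro ⟨z, hz, rfl⟩
  refine ⟨l, Set.ext fun y => and_congr_right fun hy => ?_⟩
  exact ⟨fun hyz w hw => hyz ▸ h w hw, fun hmax => (h y hy).antisymm (hmax z hz)⟩

theorem exists_mem_extremePoints_forall_apply_le [TopologicalSpace E] [T2Space E]
    [IsTopologicalAddGroup E] [ContinuousSMul ℝ E] [LocallyConvexSpace ℝ E] {D : Set E}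
    (hD : IsCompact D) (hne : D.Nonempty) (f : StrongDual ℝ E) :
    ∃ x ∈ D.extremePoints ℝ, ∀ y ∈ D, f y ≤ f x := by
  have hexp : IsExposed ℝ D (f.toExposed D) := ContinuousLinearMap.toExposed.isExposed
  obtain ⟨m, hm, hmax⟩ := hD.exists_isMaxOn hne f.continuous.continuousOn
  obtain ⟨x, hx⟩ := (hexp.isCompact hD).extremePoints_nonempty ⟨m, hm, hmax⟩
  exact ⟨x, hexp.isExtreme.extremePoints_subset_extremePoints hx, hx.1.2⟩

end Polyhedra

section PolarBody

variable {E : Type*} [NormedAddCommGroup E] [NormedSpace ℝ E]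

/-- The one-sided polar of a set; its extreme points correspond to the facets of the convex
hull. -/
def polarBody (T : Set E) : Set (StrongDual ℝ E) :=
  {l | ∀ v ∈ T, l v ≤ 1}

theorem isClosed_polarBody (T : Set E) : IsClosed (polarBody T) := by
  simp only [polarBody, Set.ofPred_forall]
  exact isClosed_biInter fun v _ =>
    isClosed_le (ContinuousLinearMap.apply ℝ ℝ v).continuous continuous_const

theorem isBounded_polarBody {T : Set E} (hT : convexHull ℝ T ∈ 𝓝 0) :
    Bornology.IsBounded (polarBody T) := by
  obtain ⟨δ, hδ, hball⟩ := Metric.nhds_basis_closedBall.mem_iff.1 hT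
  refine isBounded_iff_forall_norm_le.2 ⟨1 / δ, fun l hl => ?_⟩
  refine l.opNorm_le_bound (by positivity) (LinearMap.bound_of_ball_bound' hδ 1 l.toLinearMap ?_)
  intro z hz
  have hle : ∀ y ∈ Metric.closedBall 0 δ, l y ≤ 1 := fun y hy =>
    le_of_mem_convexHull (l := l.toLinearMap) hl (hball hy)
  have hneg := hle (-z) (by simpa using hz)
  rw [map_neg] at hneg
  exact abs_le.2 ⟨by simpa using neg_le.1 hneg, hle z hz⟩

theorem exists_mem_polarBody_one_lt {T : Set E} (hT : IsClosed (convexHull ℝ T))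
    (h0 : 0 ∈ convexHull ℝ T) {x : E} (hx : x ∉ convexHull ℝ T) :
    ∃ l ∈ polarBody T, 1 < l x := by
  obtain ⟨f, u, hfu, hux⟩ := geometric_hahn_banach_closed_point (convex_convexHull ℝ T) hT hx
  have hu : 0 < u := by simpa using hfu 0 h0
  refine ⟨u⁻¹ • f, fun v hv => ?_, ?_⟩
  · rw [smul_apply, smul_eq_mul, inv_mul_le_one₀ hu]
    exact (hfu v (subset_convexHull ℝ T hv)).le
  · rwa [smul_apply, smul_eq_mul, one_lt_inv_mul₀ hu]

theorem eventually_add_smul_mem_polarBody {T : Set E} (hT : T.Finite) {l d : StrongDual ℝ E}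
    (hl : l ∈ polarBody T) (hd : ∀ v ∈ T, l v = 1 → d v = 0) :
    ∀ᶠ ε : ℝ in 𝓝 0, l + ε • d ∈ polarBody T := by
  refine (Filter.eventually_all_finite hT).2 fun v hv => ?_
  rcases (hl v hv).lt_or_eq with h | h
  · have hc : ContinuousAt (fun ε : ℝ => (l + ε • d) v) 0 := by
      simp only [add_apply, smul_apply]
      fun_prop
    exact (hc.eventually_lt continuousAt_const (by simpa using h)).mono fun _ h => h.le
  · simp [h, hd v hv h]

variable [FiniteDimensional ℝ E]

theorem span_eq_top_of_mem_extremePoints_polarBody {T : Set E} (hT : T.Finite)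
    {l : StrongDual ℝ E} (hl : l ∈ (polarBody T).extremePoints ℝ) :
    Submodule.span ℝ {v ∈ T | l v = 1} = ⊤ := by
  by_contra hne
  obtain ⟨d₀, hd₀, hker⟩ := Submodule.exists_le_ker_of_lt_top _ (lt_top_iff_ne_top.2 hne)
  set d : StrongDual ℝ E := LinearMap.toContinuousLinearMap d₀
  have hpert := eventually_add_smul_mem_polarBody hT hl.1 (d := d) fun v hv h =>
    hker (Submodule.subset_span ⟨hv, h⟩)
  obtain ⟨r, hr, hmem⟩ := Metric.nhds_basis_closedBall.eventually_iff.1 hpert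
  have hpos : l + r • d ∈ polarBody T := hmem (by simp [abs_of_pos hr])
  have hneg : l + (-r) • d ∈ polarBody T := hmem (by simp [abs_of_pos hr])
  have hseg : l ∈ openSegment ℝ (l + r • d) (l + (-r) • d) :=
    ⟨1 / 2, 1 / 2, by norm_num, by norm_num, by norm_num, by module⟩
  have hd : d = 0 := by simpa [hr.ne'] using hl.2 hpos hneg hseg
  exact hd₀ (LinearMap.toContinuousLinearMap.map_eq_zero_iff.1 hd)

theorem exists_mem_polarBody_span_eq_top {T : Set E} (hT : T.Finite)
    (h0 : convexHull ℝ T ∈ 𝓝 0) {x : E} (hx : x ∉ convexHull ℝ T) :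
    ∃ l ∈ polarBody T, 1 < l x ∧ Submodule.span ℝ {v ∈ T | l v = 1} = ⊤ := by
  obtain ⟨w, hw, hwx⟩ :=
    exists_mem_polarBody_one_lt (hT.isCompact_convexHull ℝ).isClosed (mem_of_mem_nhds h0) hx
  have hcompact : IsCompact (polarBody T) :=
    Metric.isCompact_of_isClosed_isBounded (isClosed_polarBody T) (isBounded_polarBody h0)
  obtain ⟨l, hl, hmax⟩ := exists_mem_extremePoints_forall_apply_le hcompact ⟨w, hw⟩
    (ContinuousLinearMap.apply ℝ ℝ x)
  exact ⟨l, hl.1, hwx.trans_le (hmax w hw), span_eq_top_of_mem_extremePoints_polarBody hT hl⟩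

end PolarBody

section Facets

variable {V : Type*} {P F : Set (V → ℝ)}

theorem IsFacet.ne (hF : IsFacet P F) : F ≠ P := by
  rintro rfl
  exact absurd hF.2.2 (Nat.succ_ne_self _)

theorem IsFacet.exists_eq_setOf (hF : IsFacet P F) :
    ∃ (l : StrongDual ℝ (V → ℝ)) (c : ℝ), (∀ y ∈ P, l y ≤ c) ∧ F = {y ∈ P | l y = c} := by
  obtain ⟨l, hl⟩ := hF.1 hF.2.1
  obtain ⟨z, hz⟩ := hF.2.1
  rw [hl] at hz
  refine ⟨l, l z, hz.2, hl.trans (Set.ext fun y => and_congr_right fun hy => ?_)⟩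
  exact ⟨fun h => (hz.2 y hy).antisymm (h z hz.1), fun h w hw => h ▸ hz.2 w hw⟩

variable [Finite V]

theorem IsFacet.vectorSpan_eq (hF : IsFacet P F) {A : (V → ℝ) →ₗ[ℝ] ℝ} {b : ℝ}
    (hFA : ∀ y ∈ F, A y = b) {z : V → ℝ} (hz : z ∈ P) (hAz : A z ≠ b) :
    vectorSpan ℝ F = vectorSpan ℝ P ⊓ LinearMap.ker A := by
  obtain ⟨y, hy⟩ := hF.2.1
  apply Submodule.eq_of_le_of_finrank_le
  · exact le_inf (vectorSpan_mono ℝ hF.1.subset) (vectorSpan_le_ker hFA)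
  · refine Nat.le_of_lt_succ ((Submodule.finrank_lt_finrank_of_lt ?_).trans_eq hF.2.2.symm)
    refine inf_lt_left.2 fun h => hAz ?_
    have hzy := h (vsub_mem_vectorSpan ℝ hz (hF.1.subset hy))
    rw [LinearMap.mem_ker, vsub_eq_sub, map_sub, hFA y hy] at hzy
    exact sub_eq_zero.1 hzy

theorem IsFacet.eq_setOf (hF : IsFacet P F) {A : (V → ℝ) →ₗ[ℝ] ℝ} {b : ℝ}
    (hFA : ∀ y ∈ F, A y = b) {z : V → ℝ} (hz : z ∈ P) (hAz : A z ≠ b) :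
    F = {y ∈ P | A y = b} := by
  obtain ⟨l, c, -, hFl⟩ := hF.exists_eq_setOf
  obtain ⟨y, hy⟩ := hF.2.1
  refine Set.Subset.antisymm (fun x hx => ⟨hF.1.subset hx, hFA x hx⟩) fun x ⟨hx, hAx⟩ => ?_
  have hxy : x - y ∈ vectorSpan ℝ F := by
    rw [hF.vectorSpan_eq hFA hz hAz]
    refine ⟨vsub_mem_vectorSpan ℝ hx (hF.1.subset hy), ?_⟩
    rw [SetLike.mem_coe, LinearMap.mem_ker, map_sub, hAx, hFA y hy, sub_self]
  have hl : l (x - y) = 0 :=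
    vectorSpan_le_ker (l := l.toLinearMap) (fun w hw => (hFl ▸ hw : w ∈ {y ∈ P | l y = c}).2) hxy
  rw [hFl] at hy ⊢
  exact ⟨hx, by rw [← hy.2, ← sub_eq_zero, ← map_sub, hl]⟩

theorem IsFacet.notMem_interior (hF : IsFacet P F) {y : V → ℝ} (hy : y ∈ F) :
    y ∉ interior P := by
  intro hint
  have := Fintype.ofFinite V
  obtain ⟨l, c, hle, hFl⟩ := hF.exists_eq_setOf
  have hmax : IsLocalMax l y := by
    filter_upwards [mem_interior_iff_mem_nhds.1 hint] with z hz
    rw [hFl] at hy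
    exact hy.2 ▸ hle z hz
  have hl : l = 0 := by simpa using hmax.fderiv_eq_zero
  refine hF.ne (hFl.trans (Set.sep_eq_self_iff_mem_true.2 fun z _ => ?_))
  rw [hFl] at hy
  rw [← hy.2, hl, zero_apply, zero_apply]

theorem IsFacet.exists_eq_of_description {ι : Type*} [Finite ι] (hF : IsFacet P F)
    {A : ι → StrongDual ℝ (V → ℝ)} {b : ι → ℝ} (hP : P = {x | ∀ i, A i x ≤ b i})
    (hlt : ∀ i, ∃ y ∈ P, A i y < b i) : ∃ i, F = {x ∈ P | A i x = b i} := by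
  have hle : ∀ i, ∀ y ∈ P, A i y ≤ b i := fun i y hy => by
    rw [hP] at hy
    exact hy i
  have hconv : Convex ℝ P := by
    rw [hP, Set.ofPred_forall]
    exact convex_iInter fun i => convex_halfSpace_le (A i).toLinearMap.isLinear _
  obtain ⟨i, hi⟩ : ∃ i, ∀ y ∈ F, A i y = b i := by
    by_contra! hcon
    obtain ⟨y, hy, hyA⟩ := exists_forall_apply_lt (A := fun i => (A i).toLinearMap)
      (hF.1.convex hconv) hF.2.1 (fun i y hy => hle i y (hF.1.subset hy)) fun i =>
        (hcon i).imp fun y hy => ⟨hy.1, (hle i y (hF.1.subset hy.1)).lt_of_ne hy.2⟩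
    refine hF.notMem_interior hy (mem_interior_iff_mem_nhds.2 ?_)
    have hev : ∀ᶠ z in 𝓝 y, ∀ i, A i z < b i := Filter.eventually_all.2 fun i =>
      (A i).continuous.continuousAt.eventually_lt continuousAt_const (hyA i)
    filter_upwards [hev] with z hz
    rw [hP]
    exact fun i => (hz i).le
  obtain ⟨z, hz, hlt⟩ := hlt i
  exact ⟨i, hF.eq_setOf (A := (A i).toLinearMap) hi hz hlt.ne⟩

theorem IsFacet.lt_of_lt (hF : IsFacet P F) (hP : vectorSpan ℝ P = ⊤)
    {l A : (V → ℝ) →ₗ[ℝ] ℝ} {c b : ℝ} (hl : ∀ y ∈ P, l y ≤ c) (hFl : F = {y ∈ P | l y = c})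
    (hA : ∀ y ∈ P, A y ≤ b) (hFA : F = {y ∈ P | A y = b}) {x : V → ℝ} (hx : c < l x) :
    b < A x := by
  obtain ⟨y, hy⟩ := hF.2.1
  obtain ⟨z, hz, hzF⟩ := Set.exists_of_ssubset (hF.1.subset.ssubset_of_ne hF.ne)
  have hlF : ∀ w ∈ F, l w = c := fun w hw => (hFl ▸ hw : w ∈ {y ∈ P | l y = c}).2
  have hAF : ∀ w ∈ F, A w = b := fun w hw => (hFA ▸ hw : w ∈ {y ∈ P | A y = b}).2
  have hlz : l z < c := (hl z hz).lt_of_ne fun h => hzF (hFl ▸ ⟨hz, h⟩)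
  have hAz : A z < b := (hA z hz).lt_of_ne fun h => hzF (hFA ▸ ⟨hz, h⟩)
  set s : ℝ := (l x - c) / (l z - c)
  have hs : s < 0 := div_neg_of_pos_of_neg (sub_pos.2 hx) (sub_neg.2 hlz)
  have hker : x - y - s • (z - y) ∈ LinearMap.ker l := by
    rw [LinearMap.mem_ker, map_sub, map_sub, map_smul, map_sub, hlF y hy, smul_eq_mul,
      div_mul_cancel₀ _ (sub_neg.2 hlz).ne, sub_self]
  have hkerA : x - y - s • (z - y) ∈ LinearMap.ker A := by
    rw [← top_inf_eq (LinearMap.ker A), ← hP, ← hF.vectorSpan_eq hAF hz hAz.ne,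
      hF.vectorSpan_eq hlF hz hlz.ne, hP, top_inf_eq]
    exact hker
  rw [LinearMap.mem_ker, map_sub, map_sub, map_smul, map_sub, hAF y hy, smul_eq_mul] at hkerA
  linarith [mul_pos_of_neg_of_neg hs (sub_neg.2 hAz)]

theorem isFacet_setOf_eq {l : StrongDual ℝ (V → ℝ)} {c : ℝ} (hP : vectorSpan ℝ P = ⊤)
    (hle : ∀ y ∈ P, l y ≤ c) {v p : V → ℝ} (hv : v ∈ P) (hlv : l v = c)
    (hlp : l p ≠ c) (hsup : vectorSpan ℝ {y ∈ P | l y = c} ⊔ Submodule.span ℝ {v - p} = ⊤) :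
    IsFacet P {y ∈ P | l y = c} := by
  refine ⟨isExposed_setOf_apply_eq hle, ⟨v, hv, hlv⟩, ?_⟩
  rw [hP]
  apply le_antisymm
  · refine Nat.succ_le_of_lt (Submodule.finrank_lt_finrank_of_lt (lt_top_iff_ne_top.2 fun h => ?_))
    have hker : p - v ∈ LinearMap.ker l.toLinearMap :=
      vectorSpan_le_ker (l := l.toLinearMap) (fun y hy => hy.2) (h ▸ Submodule.mem_top)
    rw [LinearMap.mem_ker, map_sub, sub_eq_zero] at hker
    exact hlp (hker.trans hlv)
  · rw [← hsup]
    refine (Submodule.finrank_add_le_finrank_add_finrank _ _).trans (Nat.add_le_add_left ?_ _)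
    simpa using finrank_span_le_card (R := ℝ) ({v - p} : Set (V → ℝ))

theorem isFacet_setOf_eq_of_span_eq_top {W : Set (V → ℝ)}
    (hspan : vectorSpan ℝ (convexHull ℝ W) = ⊤) {p : V → ℝ} {l : StrongDual ℝ (V → ℝ)}
    (hl : l ≠ 0) (hle : ∀ y ∈ convexHull ℝ W, l y ≤ 1 + l p)
    (htight : Submodule.span ℝ {v ∈ -p +ᵥ W | l v = 1} = ⊤) :
    IsFacet (convexHull ℝ W) {y ∈ convexHull ℝ W | l y = 1 + l p} := by
  have hmem : ∀ v ∈ {v ∈ -p +ᵥ W | l v = 1}, p + v ∈ {y ∈ convexHull ℝ W | l y = 1 + l p} := by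
    rintro _ ⟨⟨v, hv, rfl⟩, hlv⟩
    simp only [vadd_eq_add, map_add, map_neg, add_neg_cancel_left] at hlv ⊢
    exact ⟨subset_convexHull ℝ W hv, by linarith⟩
  obtain ⟨v, hv⟩ : {v ∈ -p +ᵥ W | l v = 1}.Nonempty := by
    by_contra h
    rw [Set.not_nonempty_iff_eq_empty.1 h, Submodule.span_empty] at htight
    refine hl (ContinuousLinearMap.ext fun y => ?_)
    rw [(Submodule.mem_bot ℝ).1 (htight ▸ Submodule.mem_top : y ∈ (⊥ : Submodule ℝ (V → ℝ))),
      map_zero, zero_apply]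
  refine isFacet_setOf_eq (p := p) hspan hle (hmem v hv).1 (hmem v hv).2 (by simp) ?_
  rw [eq_top_iff, ← htight, Submodule.span_le]
  intro w hw
  have hwv : w = (p + w) - (p + v) + (p + v - p) := by abel
  rw [hwv]
  exact Submodule.add_mem_sup (vsub_mem_vectorSpan ℝ (hmem w hw) (hmem v hv))
    (Submodule.mem_span_singleton_self _)

theorem exists_isFacet_of_notMem_convexHull {W : Set (V → ℝ)} (hW : W.Finite)
    (hspan : affineSpan ℝ (convexHull ℝ W) = ⊤) {x : V → ℝ} (hx : x ∉ convexHull ℝ W) :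
    ∃ (l : StrongDual ℝ (V → ℝ)) (c : ℝ), (∀ y ∈ convexHull ℝ W, l y ≤ c) ∧ c < l x ∧
      IsFacet (convexHull ℝ W) {y ∈ convexHull ℝ W | l y = c} := by
  have := Fintype.ofFinite V
  obtain ⟨p, hp⟩ := (convex_convexHull ℝ W).interior_nonempty_iff_affineSpan_eq_top.2 hspan
  have htrans : ∀ y, -p + y ∈ convexHull ℝ (-p +ᵥ W) ↔ y ∈ convexHull ℝ W := fun y => by
    rw [convexHull_vadd, ← vadd_eq_add, Set.vadd_mem_vadd_set_iff]
  have h0 : convexHull ℝ (-p +ᵥ W) ∈ 𝓝 0 := by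
    rw [← mem_interior_iff_mem_nhds, convexHull_vadd, interior_vadd, ← neg_add_cancel p,
      ← vadd_eq_add, Set.vadd_mem_vadd_set_iff]
    exact hp
  obtain ⟨l, hl, hlx, htight⟩ :=
    exists_mem_polarBody_span_eq_top (hW.vadd_set (a := -p)) h0 (mt (htrans x).1 hx)
  have hle : ∀ y ∈ convexHull ℝ W, l y ≤ 1 + l p := fun y hy => by
    have hly : l (-p + y) ≤ 1 := le_of_mem_convexHull (l := l.toLinearMap) hl ((htrans y).2 hy)
    rw [map_add, map_neg] at hly
    linarith
  have hl0 : l ≠ 0 := by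
    rintro rfl
    exact zero_lt_one.not_gt (by simpa using hlx)
  refine ⟨l, 1 + l p, hle, ?_, isFacet_setOf_eq_of_span_eq_top ?_ hl0 hle htight⟩
  · rw [map_add, map_neg] at hlx
    linarith
  · rw [← direction_affineSpan, hspan, AffineSubspace.direction_top]

end Facets

/-! ### The stable set polytope -/

section Stab

variable {V : Type*} {G : SimpleGraph V}

theorem stab_eq_convexHull_indicator (G : SimpleGraph V) :
    stab G = convexHull ℝ ((fun I : Set V => I.indicator (1 : V → ℝ)) '' {I | G.IsIndepSet I}) := by
  classical
  unfold stab
  congr 1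
  ext v
  constructor
  · rintro ⟨hv, h01⟩
    refine ⟨{i | v i = 1}, fun i (hi : v i = 1) j (hj : v j = 1) _ hij => ?_,
      funext fun i => ?_⟩
    · simpa [hi, hj] using hv i j hij
    · rcases h01 i with h | h <;> simp [h]
  · rintro ⟨I, hI, rfl⟩
    refine ⟨fun i j hij => ?_, fun i => (Set.indicator_eq_zero_or_self I 1 i)⟩
    by_cases hi : i ∈ I
    · simp [Set.indicator_of_notMem fun hj => hI hi hj hij.ne hij]
    · simp [Set.indicator_of_notMem hi]

theorem indicator_mem_stab {I : Set V} (hI : G.IsIndepSet I) :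
    I.indicator (1 : V → ℝ) ∈ stab G := by
  rw [stab_eq_convexHull_indicator]
  exact subset_convexHull ℝ _ ⟨I, hI, rfl⟩

theorem zero_mem_stab (G : SimpleGraph V) : (0 : V → ℝ) ∈ stab G :=
  Set.indicator_empty' (1 : V → ℝ) ▸ indicator_mem_stab (Set.pairwise_empty _)

theorem single_mem_stab [DecidableEq V] (G : SimpleGraph V) (i : V) :
    Pi.single i (1 : ℝ) ∈ stab G :=
  Set.indicator_singleton i (1 : V → ℝ) ▸ indicator_mem_stab (Set.pairwise_singleton _ _)

theorem le_of_mem_stab {l : (V → ℝ) →ₗ[ℝ] ℝ} {c : ℝ}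
    (h : ∀ I : Set V, G.IsIndepSet I → l (I.indicator 1) ≤ c) {x : V → ℝ} (hx : x ∈ stab G) :
    l x ≤ c := by
  rw [stab_eq_convexHull_indicator] at hx
  exact le_of_mem_convexHull (Set.forall_mem_image.2 h) hx

theorem nonneg_of_mem_stab {x : V → ℝ} (hx : x ∈ stab G) (i : V) : 0 ≤ x i :=
  neg_nonpos.1 <| le_of_mem_stab (l := -LinearMap.proj i)
    (fun _ _ => neg_nonpos.2 (Set.indicator_nonneg (fun _ _ => zero_le_one) i)) hx

section Finite

variable [Finite V]

theorem isClosed_stab (G : SimpleGraph V) : IsClosed (stab G) := by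
  have := Fintype.ofFinite V
  rw [stab_eq_convexHull_indicator]
  exact ((Set.toFinite _).isCompact_convexHull ℝ).isClosed

theorem vectorSpan_stab (G : SimpleGraph V) : vectorSpan ℝ (stab G) = ⊤ := by
  classical
  rw [eq_top_iff, ← (Pi.basisFun ℝ V).span_eq, Submodule.span_le]
  rintro _ ⟨i, rfl⟩
  simpa using vsub_mem_vectorSpan ℝ (single_mem_stab G i) (zero_mem_stab G)

theorem exists_isFacet_of_notMem_stab {x : V → ℝ} (hx : x ∉ stab G) :
    ∃ (l : StrongDual ℝ (V → ℝ)) (c : ℝ), (∀ y ∈ stab G, l y ≤ c) ∧ c < l x ∧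
      IsFacet (stab G) {y ∈ stab G | l y = c} := by
  have hspan : affineSpan ℝ (stab G) = ⊤ :=
    (AffineSubspace.affineSpan_eq_top_iff_vectorSpan_eq_top_of_nonempty ℝ _ _
      ⟨0, zero_mem_stab G⟩).2 (vectorSpan_stab G)
  rw [stab_eq_convexHull_indicator] at hx hspan ⊢
  exact exists_isFacet_of_notMem_convexHull (Set.toFinite _) hspan hx

end Finite

end Stab

section OddClosedWalk

theorem cycleGraph_adj_iff {n : ℕ} (hn : 1 ≤ n) {u v : Fin (n + 1)} :
    (SimpleGraph.cycleGraph (n + 1)).Adj u v ↔ v = u + 1 ∨ u = v + 1 := by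
  obtain ⟨m, rfl⟩ := Nat.exists_eq_add_of_le' hn
  rw [SimpleGraph.cycleGraph_adj, sub_eq_iff_eq_add', sub_eq_iff_eq_add', add_comm v, or_comm]

variable {V : Type*} {G : SimpleGraph V} {a : ℕ}

/-- A closed walk of length `2a + 1`, given by the cyclic sequence of its vertices. Chords can be
cut off closed walks without leaving the notion, which is not true of cycles. -/
def IsOddClosedWalk (G : SimpleGraph V) (a : ℕ) (f : Fin (2 * a + 1) → V) : Prop :=
  ∀ k, G.Adj (f k) (f (k + 1))

theorem IsOddCycle.exists_isOddClosedWalk {C : Finset V} (hC : IsOddCycle G a C) :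
    ∃ f : Fin (2 * a + 1) → V, IsOddClosedWalk G a f ∧ f.Injective ∧ Set.range f = C := by
  obtain ⟨ha, f, hf⟩ := hC
  exact ⟨f, fun k => f.toHom.map_adj ((cycleGraph_adj_iff (by lia)).2 (.inl rfl)), f.injective, hf⟩

theorem sum_eq_sum_of_range_eq {ι M : Type*} [Fintype ι] [AddCommMonoid M] {C : Finset V}
    {f : ι → V} (hinj : f.Injective) (hf : Set.range f = C) (x : V → M) :
    ∑ i ∈ C, x i = ∑ k, x (f k) := by
  classical
  rw [← Finset.sum_image hinj.injOn]
  congr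
  rw [← Finset.coe_inj, ← hf, Finset.coe_image, Finset.coe_univ, Set.image_univ]

theorem IsOddClosedWalk.card_le {f : Fin (2 * a + 1) → V} (hf : IsOddClosedWalk G a f) {I : Set V}
    [DecidablePred (f · ∈ I)] (hI : G.IsIndepSet I) :
    Finset.card {k | f k ∈ I} ≤ a := by
  have hshift : Finset.card {k | f (k + 1) ∈ I} = Finset.card {k | f k ∈ I} :=
    Finset.card_equiv (Equiv.addRight 1) (by simp)
  have hdisj : Disjoint ({k | f k ∈ I} : Finset (Fin (2 * a + 1)))
      ({k | f (k + 1) ∈ I} : Finset (Fin (2 * a + 1))) :=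
    Finset.disjoint_filter.2 fun k _ hk hk' => hI hk hk' (hf k).ne (hf k)
  have hcard := Finset.card_le_univ (Finset.disjUnion _ _ hdisj)
  rw [Finset.card_disjUnion, hshift, Fintype.card_fin] at hcard
  lia

end OddClosedWalk

section HStab

variable {V : Type*} {G : SimpleGraph V} {s : Finset V} {b : ℕ}

/-- The linear functional summing the coordinates in `s`. -/
noncomputable def coordSum (s : Finset V) : StrongDual ℝ (V → ℝ) :=
  ∑ i ∈ s, ContinuousLinearMap.proj i

@[simp]
theorem coordSum_apply (s : Finset V) (x : V → ℝ) : coordSum s x = ∑ i ∈ s, x i := by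
  simp [coordSum]

/-- The pairs `(s, b)` for which `∑ i ∈ s, x i ≤ b` is one of the clique and odd cycle
inequalities in the definition of `h`-perfection. -/
inductive IsHInequality (G : SimpleGraph V) : Finset V → ℕ → Prop
  | clique {K : Finset V} : G.IsClique (K : Set V) → IsHInequality G K 1
  | oddCycle {a : ℕ} {C : Finset V} : IsOddCycle G a C → IsHInequality G C a

/-- The polytope cut out by the nonnegativity, clique and odd cycle inequalities. -/
def hstab (G : SimpleGraph V) : Set (V → ℝ) :=
  {x | (∀ i, 0 ≤ x i) ∧ ∀ s b, IsHInequality G s b → ∑ i ∈ s, x i ≤ b}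

theorem IsHInequality.pos (h : IsHInequality G s b) : 0 < b := by
  cases h with
  | clique => exact one_pos
  | oddCycle hC => exact hC.1

theorem IsHInequality.le_card_add_one (h : IsHInequality G s b) : b ≤ s.card + 1 := by
  cases h with
  | clique => exact Nat.le_add_left _ _
  | oddCycle hC =>
    obtain ⟨f, -, hinj, hf⟩ := hC.exists_isOddClosedWalk
    have := sum_eq_sum_of_range_eq hinj hf fun _ => 1
    simp only [Finset.sum_const, smul_eq_mul, mul_one, Finset.card_univ, Fintype.card_fin] at this
    lia

theorem IsHInequality.sum_le_of_mem_stab (h : IsHInequality G s b) {x : V → ℝ}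
    (hx : x ∈ stab G) : ∑ i ∈ s, x i ≤ b := by
  classical
  rw [← coordSum_apply]
  refine le_of_mem_stab (l := (coordSum s).toLinearMap) (fun I hI => ?_) hx
  cases h with
  | clique hK =>
    simp only [ContinuousLinearMap.coe_coe, coordSum_apply, Set.indicator_apply, Pi.one_apply,
      Finset.sum_boole, Nat.cast_le, Finset.card_le_one, Finset.mem_filter]
    exact fun i hi j hj => by_contra fun hij => hI hi.2 hj.2 hij (hK hi.1 hj.1 hij)
  | oddCycle hC =>
    obtain ⟨f, hwalk, hinj, hf⟩ := hC.exists_isOddClosedWalk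
    simp only [ContinuousLinearMap.coe_coe, coordSum_apply, sum_eq_sum_of_range_eq hinj hf,
      Set.indicator_apply, Pi.one_apply, Finset.sum_boole, Nat.cast_le]
    exact hwalk.card_le hI

theorem stab_subset_hstab (G : SimpleGraph V) : stab G ⊆ hstab G := fun _ hx =>
  ⟨nonneg_of_mem_stab hx, fun _ _ h => h.sum_le_of_mem_stab hx⟩

variable [Finite V]

instance (G : SimpleGraph V) : Finite {p : Finset V × ℕ // IsHInequality G p.1 p.2} := by
  have := Fintype.ofFinite V
  refine (((Set.finite_univ (α := Finset V)).prod
    (Set.finite_Iic (Fintype.card V + 1))).subset fun p hp => ?_).to_subtype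
  exact ⟨trivial, (IsHInequality.le_card_add_one hp).trans
    (Nat.add_le_add_right (Finset.card_le_univ _) 1)⟩

theorem isHPerfect_of_hstab_subset_stab (h : hstab G ⊆ stab G) : IsHPerfect G := by
  classical
  intro F hF
  let A : V ⊕ {p : Finset V × ℕ // IsHInequality G p.1 p.2} → StrongDual ℝ (V → ℝ) :=
    Sum.elim (fun i => -ContinuousLinearMap.proj i) fun p => coordSum p.1.1
  let b : V ⊕ {p : Finset V × ℕ // IsHInequality G p.1 p.2} → ℝ :=
    Sum.elim 0 fun p => p.1.2
  have hdesc : stab G = {x | ∀ i, A i x ≤ b i} := by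
    rw [(stab_subset_hstab G).antisymm h]
    ext x
    simp [hstab, A, b, Sum.forall]
  have hlt : ∀ i, ∃ y ∈ stab G, A i y < b i := by
    rintro (i | ⟨p, hp⟩)
    · exact ⟨_, single_mem_stab G i, by simp [A, b]⟩
    · exact ⟨_, zero_mem_stab G, by simpa [A, b] using hp.pos⟩
  obtain ⟨i | ⟨p, hp⟩, hi⟩ := hF.exists_eq_of_description hdesc hlt
  · exact .inl ⟨i, by simpa [A, b] using hi⟩
  · have hi' : F = {x ∈ stab G | ∑ i ∈ p.1, x i = p.2} := by simpa [A, b] using hi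
    rcases p with ⟨s, n⟩
    cases hp with
    | clique hK => exact .inr (.inl ⟨s, hK, by simpa using hi'⟩)
    | oddCycle hC => exact .inr (.inr ⟨n, s, hC, hi'⟩)

theorem IsHPerfect.hstab_subset_stab (hG : IsHPerfect G) : hstab G ⊆ stab G := by
  intro x hx
  by_contra hxG
  obtain ⟨l, c, hle, hlx, hF⟩ := exists_isFacet_of_notMem_stab hxG
  have violated : ∀ (A : StrongDual ℝ (V → ℝ)) (b : ℝ), (∀ y ∈ stab G, A y ≤ b) →
      {y ∈ stab G | l y = c} = {y ∈ stab G | A y = b} → b < A x := fun A b hA hFA =>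
    hF.lt_of_lt (l := l.toLinearMap) (A := A.toLinearMap) (vectorSpan_stab G) hle rfl hA hFA hlx
  have sum_violated : ∀ s b, IsHInequality G s b →
      {y ∈ stab G | l y = c} ≠ {y ∈ stab G | ∑ i ∈ s, y i = b} := fun s b h hFA => by
    refine (hx.2 s b h).not_gt ?_
    simpa using violated (coordSum s) b (by simpa using fun y => h.sum_le_of_mem_stab)
      (by simpa using hFA)
  rcases hG _ hF with ⟨i, hi⟩ | ⟨K, hK, hi⟩ | ⟨a, C, hC, hi⟩
  · have := violated (-ContinuousLinearMap.proj i) 0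
      (by simpa using fun y hy => nonneg_of_mem_stab hy i) (by simpa using hi)
    exact (hx.1 i).not_gt (by simpa using this)
  · exact sum_violated K 1 (.clique hK) (by simpa using hi)
  · exact sum_violated C a (.oddCycle hC) hi

end HStab

/-! ### Perfect graphs and odd cycles -/

section Multicolorable

variable {V : Type*} {G : SimpleGraph V} {N : ℕ} {y : V → ℕ}

/-- Every vertex `i` can be given a set of `y i` of the `N` colours, such that adjacent vertices
get disjoint sets. Equivalently, `y` is a sum of `N` incidence vectors of independent sets. -/
def Multicolorable (G : SimpleGraph V) (N : ℕ) (y : V → ℕ) : Prop :=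
  ∃ c : V → Finset (Fin N), (∀ i, (c i).card = y i) ∧ ∀ i j, G.Adj i j → Disjoint (c i) (c j)

theorem multicolorable_of_fintype {κ : Type*} [Fintype κ] (hN : Fintype.card κ = N)
    (c : V → Finset κ) (hy : ∀ i, (c i).card = y i)
    (hc : ∀ i j, G.Adj i j → Disjoint (c i) (c j)) : Multicolorable G N y :=
  ⟨fun i => (c i).map (Fintype.equivFinOfCardEq hN).toEmbedding,
    fun i => (Finset.card_map _).trans (hy i),
    fun i j hij => (Finset.disjoint_map _).2 (hc i j hij)⟩

theorem Multicolorable.div_mem_stab (h : Multicolorable G N y) (hN : 0 < N) :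
    (fun i => (y i : ℝ) / N) ∈ stab G := by
  obtain ⟨c, hy, hc⟩ := h
  have hindep : ∀ t, G.IsIndepSet {i | t ∈ c i} := fun t i hi j hj _ hij =>
    Finset.disjoint_left.1 (hc i j hij) hi hj
  have hmean : ∑ t : Fin N, (N : ℝ)⁻¹ • {i | t ∈ c i}.indicator 1 ∈ stab G :=
    (convex_convexHull ℝ _).sum_mem (fun _ _ => by positivity)
      (by simp [(Nat.cast_pos.2 hN).ne']) fun t _ => indicator_mem_stab (hindep t)
  convert hmean using 1
  ext i
  simp [Set.indicator_apply, ← hy, div_eq_mul_inv]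

theorem mem_stab_of_multicolorable_floor [Finite V] {x : V → ℝ} (hx : ∀ i, 0 ≤ x i)
    (h : ∀ N : ℕ, 0 < N → Multicolorable G N fun i => ⌊x i * N⌋₊) : x ∈ stab G := by
  have hlim : Filter.Tendsto (fun N : ℕ => fun i => (⌊x i * (N : ℝ)⌋₊ : ℝ) / (N : ℝ))
      Filter.atTop (𝓝 x) :=
    tendsto_pi_nhds.2 fun i =>
      (tendsto_nat_floor_mul_div_atTop (hx i)).comp tendsto_natCast_atTop_atTop
  refine (isClosed_stab G).mem_of_tendsto hlim ?_
  filter_upwards [Filter.eventually_gt_atTop 0] with N hN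
  exact (h N hN).div_mem_stab hN

theorem sum_floor_mul_le {ι R : Type*} [Field R] [LinearOrder R] [IsStrictOrderedRing R]
    [FloorSemiring R] {s : Finset ι} {x : ι → R} (hx : ∀ i, 0 ≤ x i) {b : ℕ}
    (h : ∑ i ∈ s, x i ≤ b) (N : ℕ) : ∑ i ∈ s, ⌊x i * N⌋₊ ≤ b * N := by
  refine (Nat.cast_le (α := R)).1 ?_
  push_cast
  calc ∑ i ∈ s, (⌊x i * N⌋₊ : R) ≤ ∑ i ∈ s, x i * N :=
        Finset.sum_le_sum fun i _ => Nat.floor_le (mul_nonneg (hx i) (Nat.cast_nonneg N))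
    _ = (∑ i ∈ s, x i) * N := (Finset.sum_mul _ _ _).symm
    _ ≤ b * N := mul_le_mul_of_nonneg_right h (Nat.cast_nonneg N)

theorem multicolorable_indicator {s : Set V} (h : (G.induce s).Colorable N) :
    Multicolorable G N (s.indicator 1) := by
  classical
  obtain ⟨C⟩ := h
  refine ⟨fun i => if hi : i ∈ s then {C ⟨i, hi⟩} else ∅, fun i => ?_, fun i j hij => ?_⟩
  · by_cases hi : i ∈ s <;> simp [hi]
  · by_cases hi : i ∈ s <;> by_cases hj : j ∈ s <;> simp only [hi, hj, dite_true, dite_false,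
      Finset.disjoint_empty_left, Finset.disjoint_empty_right, Finset.disjoint_singleton]
    exact C.valid (v := ⟨i, hi⟩) (w := ⟨j, hj⟩) hij

theorem Multicolorable.add_indicator (h : Multicolorable G N y) {I : Set V}
    (hI : G.IsIndepSet I) : Multicolorable G (N + 1) (y + I.indicator 1) := by
  classical
  obtain ⟨c, hy, hc⟩ := h
  have hsome : ∀ i j, G.Adj i j → ∀ t, t ∈ c i → t ∉ c j := fun i j hij _ ht =>
    Finset.disjoint_left.1 (hc i j hij) ht
  refine multicolorable_of_fintype (κ := Option (Fin N)) (by simp)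
    (fun i => if i ∈ I then (c i).insertNone else (c i).map .some) (fun i => ?_) fun i j hij => ?_
  · by_cases hi : i ∈ I <;> simp [hi, hy]
  · have hij' : ¬(i ∈ I ∧ j ∈ I) := fun h => hI h.1 h.2 hij.ne hij
    rw [Finset.disjoint_left]
    by_cases hi : i ∈ I <;> by_cases hj : j ∈ I <;>
      first | simp_all; done | simpa [Option.forall, hi, hj] using hsome i j hij

end Multicolorable

section Perfect

variable {V : Type*} {G : SimpleGraph V} {N : ℕ} {y : V → ℕ}

theorem IsPerfect.colorable_induce [Finite V] (hG : IsPerfect G) {s : Set V}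
    (hN : ∀ K : Finset V, G.IsClique (K : Set V) → (K : Set V) ⊆ s → K.card ≤ N) :
    (G.induce s).Colorable N := by
  rw [← SimpleGraph.chromaticNumber_le_iff_colorable, hG s, Nat.cast_le]
  obtain ⟨K, hK⟩ := (G.induce s).exists_isNClique_cliqueNum
  rw [← hK.card_eq, ← Finset.card_map (Function.Embedding.subtype (· ∈ s))]
  refine hN _ ?_ (by simp)
  rw [Finset.coe_map]
  rintro _ ⟨u, hu, rfl⟩ _ ⟨v, hv, rfl⟩ huv
  exact hK.isClique hu hv (ne_of_apply_ne _ huv)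

theorem exists_isIndepSet_sum_le [DecidableEq V] {i : V} (hi : 2 ≤ y i)
    (hK : ∀ K : Finset V, G.IsClique (K : Set V) → ∑ j ∈ K, y j ≤ N + 1)
    (h : Multicolorable G (N + 1) (y - Pi.single i 1)) :
    ∃ I : Set V, G.IsIndepSet I ∧ i ∈ I ∧ I.indicator 1 ≤ y ∧
      ∀ K : Finset V, G.IsClique (K : Set V) → ∑ j ∈ K, (y - (I.indicator 1 : V → ℕ)) j ≤ N := by
  obtain ⟨c, hy, hc⟩ := h
  have hci : (c i).card = y i - 1 := by simp [hy]
  have hcj : ∀ j, j ≠ i → (c j).card = y j := fun j hj => by simp [hy, hj]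
  obtain ⟨t, ht⟩ : (c i).Nonempty := Finset.card_pos.1 (by lia)
  have hle : {j | t ∈ c j}.indicator 1 ≤ y := by
    refine Set.indicator_le' (fun j hj => ?_) fun _ _ => Nat.zero_le _
    exact (Finset.card_pos.2 ⟨t, hj⟩).trans_le ((hy j).trans_le (Nat.sub_le _ _))
  refine ⟨{j | t ∈ c j}, fun j hj k hk _ hjk => Finset.disjoint_left.1 (hc j k hjk) hj hk, ht,
    hle, fun K hKc => ?_⟩
  by_cases hiK : i ∈ K
  · refine Nat.le_of_lt_succ (lt_of_lt_of_le ?_ (hK K hKc))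
    refine Finset.sum_lt_sum (fun j _ => Nat.sub_le _ _) ⟨i, hiK, ?_⟩
    simp [ht, show 0 < y i by lia]
  · calc ∑ j ∈ K, (y - ({j | t ∈ c j}.indicator 1 : V → ℕ)) j
        = ∑ j ∈ K, ((c j).erase t).card := Finset.sum_congr rfl fun j hj => by
          rw [Finset.card_erase_eq_ite, hcj j (ne_of_mem_of_not_mem hj hiK)]
          by_cases htj : t ∈ c j <;> simp [htj]
      _ = (K.biUnion fun j => (c j).erase t).card := (Finset.card_biUnion fun j hj k hk hjk =>
          (hc j k (hKc hj hk hjk)).mono (Finset.erase_subset _ _) (Finset.erase_subset _ _)).symm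
      _ ≤ (Finset.univ.erase t).card := Finset.card_le_card <| Finset.biUnion_subset.2
          fun j _ => Finset.erase_subset_erase t (Finset.subset_univ _)
      _ = N := by simp

theorem IsPerfect.multicolorable [Finite V] (hG : IsPerfect G)
    (hK : ∀ K : Finset V, G.IsClique (K : Set V) → ∑ i ∈ K, y i ≤ N) : Multicolorable G N y := by
  classical
  induction y using WellFoundedLT.induction generalizing N with
  | ind y ih =>
  by_cases hy : ∀ i, y i ≤ 1
  · have hyind : y = {i | y i = 1}.indicator 1 := by
      ext i
      have := hy i
      by_cases hi : y i = 1
      · simp [hi]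
      · simpa [hi] using show y i = 0 by lia
    rw [hyind]
    refine multicolorable_indicator (hG.colorable_induce fun K hKc hKs => ?_)
    simpa [Finset.sum_congr rfl fun i hi => (hKs hi : y i = 1)] using hK K hKc
  · push Not at hy
    obtain ⟨i, hi⟩ := hy
    obtain ⟨N, rfl⟩ : ∃ M, N = M + 1 :=
      Nat.exists_eq_add_of_le' (hi.le.trans (by simpa using hK {i} (by simp)))
    have hlt : y - Pi.single i 1 < y := by
      refine Pi.lt_def.2 ⟨fun j => Nat.sub_le _ _, i, ?_⟩
      simp [show 0 < y i by lia]
    obtain ⟨I, hI, hiI, hle, hKI⟩ := exists_isIndepSet_sum_le hi hK <| ih _ hlt fun K hKc =>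
      (Finset.sum_le_sum fun j _ => Nat.sub_le _ _).trans (hK K hKc)
    have hltI : y - I.indicator 1 < y := by
      refine Pi.lt_def.2 ⟨fun j => Nat.sub_le _ _, i, ?_⟩
      simp [hiI, show 0 < y i by lia]
    rw [← tsub_add_cancel_of_le hle]
    exact (ih _ hltI hKI).add_indicator hI

theorem IsPerfect.isHPerfect [Finite V] (hG : IsPerfect G) : IsHPerfect G :=
  isHPerfect_of_hstab_subset_stab fun x hx => mem_stab_of_multicolorable_floor hx.1 fun N _ =>
    hG.multicolorable fun K hK => by
      simpa using sum_floor_mul_le hx.1 (hx.2 K 1 (.clique hK)) N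

end Perfect

section OddCycle

theorem exists_sum_eq_of_le_of_le {ι M : Type*} [AddCommGroup M] [LinearOrder M]
    [IsOrderedAddMonoid M] (s : Finset ι) {lo hi : ι → M} (h : ∀ i ∈ s, lo i ≤ hi i) {T : M}
    (hlo : ∑ i ∈ s, lo i ≤ T) (hhi : T ≤ ∑ i ∈ s, hi i) :
    ∃ d : ι → M, (∀ i ∈ s, lo i ≤ d i ∧ d i ≤ hi i) ∧ ∑ i ∈ s, d i = T := by
  classical
  induction s using Finset.induction_on generalizing T with
  | empty => exact ⟨lo, by simp, by simpa using hlo.antisymm hhi⟩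
  | insert i s his ih =>
    rw [Finset.sum_insert his] at hlo hhi
    rw [Finset.forall_mem_insert] at h
    set e := max (lo i) (T - ∑ j ∈ s, hi j)
    have hei : e ≤ hi i := max_le h.1 (sub_le_iff_le_add.2 hhi)
    have hlo' : ∑ j ∈ s, lo j ≤ T - e := le_sub_comm.1 <| max_le (le_sub_right_of_add_le hlo) <|
      sub_le_sub_left (Finset.sum_le_sum h.2) T
    have hhi' : T - e ≤ ∑ j ∈ s, hi j := sub_le_comm.1 (le_max_right _ _)
    obtain ⟨d, hd, hdT⟩ := ih h.2 hlo' hhi'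
    have hne : ∀ j ∈ s, j ≠ i := fun j hj => ne_of_mem_of_not_mem hj his
    refine ⟨Function.update d i e, (Finset.forall_mem_insert _ _ _).2 ⟨?_, fun j hj => ?_⟩, ?_⟩
    · simpa using ⟨le_max_left _ _, hei⟩
    · simpa [hne j hj] using hd j hj
    · rw [Finset.sum_insert his, Function.update_self, Finset.sum_update_of_notMem his, hdT,
        add_sub_cancel]

theorem exists_cyclic_primitive {M : Type*} [AddCommMonoid M] {n : ℕ} {d : Fin (n + 1) → M}
    (hd : ∑ k, d k = 0) : ∃ s : Fin (n + 1) → M, ∀ k, s (k + 1) = s k + d k := by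
  refine ⟨fun k => ∑ i ∈ Finset.Iio k, d i, fun k => ?_⟩
  have hIic : ∑ i ∈ Finset.Iic k, d i = ∑ i ∈ Finset.Iio k, d i + d k := by
    rw [← Finset.Iio_insert, Finset.sum_insert (by simp), add_comm]
  rcases eq_or_ne k (Fin.last n) with rfl | hk
  · rw [← hIic, Fin.last_add_one, ← Fin.top_eq_last, Finset.Iic_top, hd]
    exact Finset.sum_eq_zero fun i hi => absurd (Finset.mem_Iio.1 hi) (Fin.not_lt_zero i)
  · rw [← hIic]
    refine Finset.sum_congr (Finset.ext fun i => ?_) fun _ _ => rfl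
    rw [Finset.mem_Iio, Finset.mem_Iic, Fin.lt_def, Fin.le_def, Fin.val_add_one, if_neg hk,
      Nat.lt_succ_iff]

/-- The arc of `p` consecutive residues modulo `N` starting at `s`. -/
def cyclicArc {N : ℕ} (s : ZMod N) (p : ℕ) : Finset (ZMod N) :=
  (Finset.range p).image fun t : ℕ => s + t

theorem card_cyclicArc {N p : ℕ} (s : ZMod N) (hp : p ≤ N) : (cyclicArc s p).card = p := by
  refine (Finset.card_image_of_injOn fun t ht u hu htu => ?_).trans (Finset.card_range p)
  rw [Finset.mem_coe, Finset.mem_range] at ht hu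
  have hmod := (ZMod.natCast_eq_natCast_iff' t u N).1 (add_left_cancel htu)
  rwa [Nat.mod_eq_of_lt (ht.trans_le hp), Nat.mod_eq_of_lt (hu.trans_le hp)] at hmod

theorem disjoint_cyclicArc {N p q : ℕ} {d : ℤ} (s : ZMod N) (hp : p ≤ d) (hd : d ≤ N - q) :
    Disjoint (cyclicArc s p) (cyclicArc (s + d) q) := by
  simp only [cyclicArc, Finset.disjoint_left, Finset.mem_image, Finset.mem_range]
  rintro _ ⟨t, ht, rfl⟩ ⟨u, hu, hut⟩
  have hcast : ((t : ℤ) : ZMod N) = ((d + u : ℤ) : ZMod N) := by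
    push_cast
    rw [add_assoc] at hut
    exact (add_left_cancel hut).symm
  have hmod := (ZMod.intCast_eq_intCast_iff' _ _ N).1 hcast
  rw [Int.emod_eq_of_lt (by lia) (by lia), Int.emod_eq_of_lt (by lia) (by lia)] at hmod
  lia

/-- Walking around the cycle, each vertex gets the arc of `y k` colours starting `d k` steps after
the start of the previous arc; the `d k` are chosen so that consecutive arcs are disjoint and the
last arc fits with the first one after `a` turns. -/
theorem multicolorable_cycleGraph {a N : ℕ} (ha : 1 ≤ a) [NeZero N] {y : Fin (2 * a + 1) → ℕ}
    (hedge : ∀ k, y k + y (k + 1) ≤ N) (hsum : ∑ k, y k ≤ a * N) :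
    Multicolorable (SimpleGraph.cycleGraph (2 * a + 1)) N y := by
  have hsum' : ∑ k, (y k : ℤ) ≤ a * N := by exact_mod_cast hsum
  have hshift : ∑ k, (y (k + 1) : ℤ) = ∑ k, (y k : ℤ) :=
    Equiv.sum_comp (Equiv.addRight 1) fun k => (y k : ℤ)
  obtain ⟨d, hd, hdsum⟩ := exists_sum_eq_of_le_of_le Finset.univ (lo := fun k => (y k : ℤ))
    (hi := fun k => N - y (k + 1)) (T := a * N) (fun k _ => by have := hedge k; lia) hsum' (by
      rw [Finset.sum_sub_distrib, hshift, Finset.sum_const, Finset.card_univ, Fintype.card_fin,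
        nsmul_eq_mul]
      push_cast
      linarith)
  obtain ⟨s, hs⟩ := exists_cyclic_primitive (d := fun k => (d k : ZMod N))
    (by simpa using congrArg (Int.cast : ℤ → ZMod N) hdsum)
  have hdisj : ∀ k, Disjoint (cyclicArc (s k) (y k)) (cyclicArc (s (k + 1)) (y (k + 1))) := by
    intro k
    rw [hs]
    exact disjoint_cyclicArc _ (hd k (Finset.mem_univ k)).1 (hd k (Finset.mem_univ k)).2
  refine multicolorable_of_fintype (ZMod.card N) (fun k => cyclicArc (s k) (y k))
    (fun k => card_cyclicArc _ ((Nat.le_add_right _ _).trans (hedge k))) fun i j hij => ?_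
  rcases (cycleGraph_adj_iff (by lia)).1 hij with rfl | rfl
  · exact hdisj i
  · exact (hdisj j).symm

theorem isHPerfect_cycleGraph {a : ℕ} (ha : 1 ≤ a) :
    IsHPerfect (SimpleGraph.cycleGraph (2 * a + 1)) := by
  refine isHPerfect_of_hstab_subset_stab fun x hx =>
    mem_stab_of_multicolorable_floor hx.1 fun N hN => ?_
  have : NeZero N := ⟨hN.ne'⟩
  refine multicolorable_cycleGraph ha (fun k => ?_) <|
    sum_floor_mul_le hx.1 (hx.2 _ _ (.oddCycle ⟨ha, SimpleGraph.Copy.id _, by simp⟩)) N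
  have hadj : (SimpleGraph.cycleGraph (2 * a + 1)).Adj k (k + 1) :=
    (cycleGraph_adj_iff (by lia)).2 (.inl rfl)
  have hclique : (SimpleGraph.cycleGraph (2 * a + 1)).IsClique
      (({k, k + 1} : Finset _) : Set (Fin (2 * a + 1))) := by
    simpa using fun _ => hadj
  simpa [Finset.sum_pair hadj.ne] using sum_floor_mul_le hx.1 (hx.2 _ _ (.clique hclique)) N

end OddCycle

/-! ### Positive functionals and frustration cycles -/

section PositiveFunctional

variable {A : Type*} [Ring A] [StarRing A] [Algebra ℂ A] {ω : A →ₗ[ℂ] ℂ}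

/-- Positive linear functionals on a complex star algebra, for instance `x ↦ tr ρ x` with `ρ`
positive semidefinite. No order on the algebra is involved. -/
def IsPositiveFunctional (ω : A →ₗ[ℂ] ℂ) : Prop :=
  ∀ x, 0 ≤ ω (star x * x)

theorem IsPositiveFunctional.map_one_nonneg (hω : IsPositiveFunctional ω) : 0 ≤ ω 1 := by
  simpa using hω 1

theorem IsPositiveFunctional.compress (hω : IsPositiveFunctional ω) (p : A) :
    IsPositiveFunctional (ω ∘ₗ LinearMap.mulLeft ℂ (star p) ∘ₗ LinearMap.mulRight ℂ p) :=
  fun x => by simpa [mul_assoc] using hω (x * p)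

variable [StarModule ℂ A]

theorem IsPositiveFunctional.map_star (hω : IsPositiveFunctional ω) (x : A) :
    ω (star x) = star (ω x) := by
  have him : ∀ y, (ω (star y * y)).im = 0 := fun y => (Complex.nonneg_iff.1 (hω y)).2.symm
  have h₁ := him (x + 1)
  have h₂ := him (x + Complex.I • (1 : A))
  simp only [star_add, star_one, star_smul, Complex.star_def, Complex.conj_I, add_mul, mul_add,
    mul_one, one_mul, smul_mul_assoc, mul_smul_comm, map_add, map_smul, smul_eq_mul, Complex.add_im,
    Complex.mul_im, Complex.mul_re, Complex.neg_re, Complex.neg_im, Complex.I_re, Complex.I_im,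
    him x, (Complex.nonneg_iff.1 hω.map_one_nonneg).2.symm] at h₁ h₂
  apply Complex.ext
  · simp only [Complex.star_def, Complex.conj_re]
    linarith
  · simp only [Complex.star_def, Complex.conj_im]
    linarith

theorem IsPositiveFunctional.re_eq (hω : IsPositiveFunctional ω) {x : A} (hx : star x = x) :
    ((ω x).re : ℂ) = ω x := by
  rw [← Complex.conj_eq_iff_re, ← Complex.star_def, ← hω.map_star, hx]

theorem IsPositiveFunctional.posSemidef_gram {κ : Type*} [Finite κ]
    (hω : IsPositiveFunctional ω) (b : κ → A) :
    (Matrix.of fun j k => ω (star (b j) * b k)).PosSemidef := by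
  have := Fintype.ofFinite κ
  refine Matrix.PosSemidef.of_dotProduct_mulVec_nonneg ?_ fun x => ?_
  · ext j k
    simp [← hω.map_star]
  · convert hω (∑ k, x k • b k) using 1
    have hsum : star (∑ k, x k • b k) * ∑ k, x k • b k =
        ∑ j, ∑ k, (star (x j) * x k) • (star (b j) * b k) := by
      simp only [star_sum, star_smul, Finset.sum_mul_sum, smul_mul_smul_comm]
    rw [hsum]
    simp only [dotProduct, Matrix.mulVec, Matrix.of_apply, map_sum, map_smul, smul_eq_mul,
      Finset.mul_sum, Pi.star_apply]
    exact Finset.sum_congr rfl fun j _ => Finset.sum_congr rfl fun k _ => by ring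

end PositiveFunctional

section Skew

variable {κ : Type*} [Fintype κ] [DecidableEq κ] {K : Matrix κ κ ℂ}

theorem sum_norm_sq_eq_sum_eigenvalues_sq (hK : K.IsHermitian) :
    ∑ j, ∑ k, ‖K j k‖ ^ 2 = ∑ i, hK.eigenvalues i ^ 2 := by
  have hfrobenius : ((∑ j, ∑ k, ‖K j k‖ ^ 2 : ℝ) : ℂ) = (K * K).trace := by
    push_cast
    refine Finset.sum_congr rfl fun j _ => Finset.sum_congr rfl fun k _ => ?_
    change _ = K j k * K k j
    rw [← hK.apply k j, Complex.star_def, Complex.mul_conj']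
  have htrace : (K * K).trace = ∑ i, (hK.eigenvalues i : ℂ) ^ 2 := by
    conv_lhs => rw [hK.spectral_theorem]
    rw [← map_mul, Unitary.conjStarAlgAut_apply, Matrix.trace_mul_comm, ← mul_assoc]
    simp [Matrix.trace_diagonal, sq]
  exact_mod_cast hfrobenius.trans htrace

theorem nonneg_add_mul_eigenvalues_of_posSemidef (hK : K.IsHermitian) {r c : ℝ}
    (hpos : ((r : ℂ) • (1 : Matrix κ κ ℂ) + (c : ℂ) • K).PosSemidef) (i : κ) :
    0 ≤ r + c * hK.eigenvalues i := by
  set v : κ → ℂ := ⇑(hK.eigenvectorBasis i)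
  have hv : star v ⬝ᵥ v = 1 := by
    rw [dotProduct_comm, ← EuclideanSpace.inner_eq_star_dotProduct, inner_self_eq_norm_sq_to_K,
      hK.eigenvectorBasis.orthonormal.1 i]
    simp
  have h := hpos.dotProduct_mulVec_nonneg v
  rw [Matrix.add_mulVec, Matrix.smul_mulVec, Matrix.smul_mulVec, Matrix.one_mulVec,
    hK.mulVec_eigenvectorBasis, dotProduct_add, dotProduct_smul, dotProduct_smul, dotProduct_smul,
    hv] at h
  have h' : (0 : ℂ) ≤ ((r + c * hK.eigenvalues i : ℝ) : ℂ) := by simpa using h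
  exact Complex.zero_le_real.1 h'

theorem sum_norm_sq_le_of_transpose_eq_neg (hcard : Odd (Fintype.card κ)) {r : ℝ}
    (hK : K.IsHermitian) (hKt : Kᵀ = -K) (hpos : ((r : ℂ) • (1 : Matrix κ κ ℂ) + K).PosSemidef) :
    ∑ j, ∑ k, ‖K j k‖ ^ 2 ≤ (Fintype.card κ - 1 : ℝ) * r ^ 2 := by
  have hneg : ((r : ℂ) • (1 : Matrix κ κ ℂ) - K).PosSemidef := by
    simpa [hKt, ← sub_eq_add_neg] using hpos.transpose
  have hbound : ∀ i, hK.eigenvalues i ^ 2 ≤ r ^ 2 := fun i => by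
    have h₁ := nonneg_add_mul_eigenvalues_of_posSemidef hK (c := 1) (by simpa using hpos) i
    have h₂ := nonneg_add_mul_eigenvalues_of_posSemidef hK (c := -1)
      (by simpa [← sub_eq_add_neg] using hneg) i
    exact sq_le_sq' (by linarith) (by linarith)
  have hdet : K.det = 0 := by
    have h : K.det = -K.det := by
      conv_lhs => rw [← Matrix.det_transpose, hKt, Matrix.det_neg, hcard.neg_one_pow, neg_one_mul]
    exact self_eq_neg.1 h
  obtain ⟨i₀, hi₀⟩ : ∃ i, hK.eigenvalues i = 0 := by
    simpa [hK.det_eq_prod_eigenvalues, Finset.prod_eq_zero_iff] using hdet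
  calc ∑ j, ∑ k, ‖K j k‖ ^ 2 = ∑ i, hK.eigenvalues i ^ 2 := sum_norm_sq_eq_sum_eigenvalues_sq hK
    _ = ∑ i ∈ Finset.univ.erase i₀, hK.eigenvalues i ^ 2 := by
        rw [← Finset.add_sum_erase _ _ (Finset.mem_univ i₀), hi₀, zero_pow two_ne_zero, zero_add]
    _ ≤ ∑ _i ∈ Finset.univ.erase i₀, r ^ 2 := Finset.sum_le_sum fun i _ => hbound i
    _ = (Fintype.card κ - 1 : ℝ) * r ^ 2 := by
        rw [Finset.sum_const, Finset.card_erase_of_mem (Finset.mem_univ i₀), Finset.card_univ,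
          nsmul_eq_mul, Nat.cast_pred (Fintype.card_pos_iff.2 ⟨i₀⟩)]

theorem two_mul_sum_apply_add_one_le {n : ℕ} (hn : 2 ≤ n) {h : Fin (n + 1) → Fin (n + 1) → ℝ}
    (hnonneg : ∀ j k, 0 ≤ h j k) (hsymm : ∀ j k, h j k = h k j) :
    2 * ∑ k, h k (k + 1) ≤ ∑ j, ∑ k, h j k := by
  have hne : ∀ j : Fin (n + 1), j + 1 ≠ j - 1 := fun j hj => by
    rw [eq_sub_iff_add_eq, add_assoc, add_eq_left] at hj
    have := congrArg Fin.val hj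
    rw [Fin.val_add, Fin.val_one', Nat.mod_eq_of_lt (a := 1) (by lia),
      Nat.mod_eq_of_lt (a := 1 + 1) (by lia)] at this
    simp at this
  have hpred : ∑ j, h j (j - 1) = ∑ j, h j (j + 1) := by
    rw [← Equiv.sum_comp (Equiv.addRight 1)]
    exact Finset.sum_congr rfl fun j _ => by simp [hsymm]
  calc 2 * ∑ k, h k (k + 1) = ∑ j, (h j (j + 1) + h j (j - 1)) := by
        rw [Finset.sum_add_distrib, hpred, two_mul]
    _ = ∑ j, ∑ k ∈ {j + 1, j - 1}, h j k :=
        Finset.sum_congr rfl fun j _ => (Finset.sum_pair (hne j)).symm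
    _ ≤ ∑ j, ∑ k, h j k := Finset.sum_le_sum fun j _ =>
        Finset.sum_le_sum_of_subset_of_nonneg (Finset.subset_univ _) fun k _ _ => hnonneg j k

end Skew

section SkewFrame

variable {A : Type*} [Ring A] [StarRing A] [Algebra ℂ A] [StarModule ℂ A] {ω : A →ₗ[ℂ] ℂ} {n : ℕ}

/-- The Gram matrix of `b` is a multiple of the identity plus a skew-symmetric matrix of odd size;
the cyclic superdiagonal and its mirror image account for only part of the Frobenius norm. -/
theorem IsPositiveFunctional.sum_norm_sq_star_mul_add_one_le (hω : IsPositiveFunctional ω)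
    (hn : 2 ≤ n) (hn' : Even n) {b : Fin (n + 1) → A} (hb : ∀ k, star (b k) * b k = 1)
    (hskew : ∀ j k, j ≠ k → star (b k) * b j = -(star (b j) * b k)) :
    ∑ k, ‖ω (star (b k) * b (k + 1))‖ ^ 2 ≤ n / 2 * (ω 1).re ^ 2 := by
  have hr : ((ω 1).re : ℂ) = ω 1 := hω.re_eq (star_one A)
  have hgram := hω.posSemidef_gram b
  set K := (Matrix.of fun j k => ω (star (b j) * b k)) - ((ω 1).re : ℂ) • 1 with hK
  have hdiag : ∀ j, K j j = 0 := fun j => by simp [hK, hb, hr]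
  have hoff : ∀ j k, j ≠ k → K j k = ω (star (b j) * b k) := fun j k hjk => by simp [hK, hjk]
  have htranspose : Kᵀ = -K := by
    ext j k
    rw [Matrix.transpose_apply, Matrix.neg_apply]
    obtain rfl | hjk := eq_or_ne j k
    · rw [hdiag, neg_zero]
    · rw [hoff _ _ hjk.symm, hoff _ _ hjk, hskew _ _ hjk, map_neg]
  have hherm : K.IsHermitian :=
    hgram.1.sub (by simp [Matrix.IsHermitian, Matrix.conjTranspose_smul])
  have hfrobenius := sum_norm_sq_le_of_transpose_eq_neg (r := (ω 1).re)
    (by simpa using hn'.add_one) hherm htranspose (by simpa [hK] using hgram)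
  have hcyclic := two_mul_sum_apply_add_one_le hn (h := fun j k => ‖K j k‖ ^ 2)
    (fun _ _ => sq_nonneg _) fun j k => by rw [← hherm.apply j k, norm_star]
  have hne : ∀ k : Fin (n + 1), k ≠ k + 1 := fun k h => by
    have := Fin.val_eq_of_eq (left_eq_add.1 h)
    simp only [Fin.val_one', Fin.val_zero, Nat.mod_eq_of_lt (show 1 < n + 1 by lia)] at this
    exact one_ne_zero this
  simp only [fun k => hoff k (k + 1) (hne k)] at hcyclic
  rw [Fintype.card_fin, Nat.cast_succ, add_sub_cancel_right] at hfrobenius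
  linarith

end SkewFrame

section SegmentProd

variable {A : Type*} [Monoid A] {X : ℕ → A}

/-- The product `X j * X (j + 1) * ⋯ * X (j + m - 1)`. -/
def segmentProd (X : ℕ → A) (j m : ℕ) : A :=
  ((List.range' j m).map X).prod

@[simp]
theorem segmentProd_zero (j : ℕ) : segmentProd X j 0 = 1 := rfl

theorem segmentProd_succ (j m : ℕ) :
    segmentProd X j (m + 1) = X j * segmentProd X (j + 1) m := by
  simp [segmentProd, List.range'_succ]

theorem segmentProd_add (j m k : ℕ) :
    segmentProd X j (m + k) = segmentProd X j m * segmentProd X (j + m) k := by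
  rw [segmentProd, ← List.range'_append_1, List.map_append, List.prod_append]
  rfl

theorem segmentProd_one (j : ℕ) : segmentProd X j 1 = X j := by
  simp [segmentProd]

end SegmentProd

section FrustrationCycle

variable {A : Type*} [Ring A] [StarRing A] {n : ℕ} {X : ℕ → A}

/-- A cycle of `n + 1` skew-adjoint square roots of `-1`, indexed periodically by `ℕ`, in which
precisely the neighbours anticommute. For an involution `S` the element `I • S` is such a root;
with it, reversing a product of consecutive elements costs a single sign whatever its length. -/
structure IsFrustrationCycle (n : ℕ) (X : ℕ → A) : Prop where
  star_eq : ∀ k, star (X k) = -X k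
  mul_self : ∀ k, X k * X k = -1
  periodic : Function.Periodic X (n + 1)
  anticommute : ∀ k, X k * X (k + 1) = -(X (k + 1) * X k)
  commute : ∀ k d, 2 ≤ d → d < n → Commute (X k) (X (k + d))

namespace IsFrustrationCycle

theorem star_segmentProd_mul_self (hX : IsFrustrationCycle n X) (j m : ℕ) :
    star (segmentProd X j m) * segmentProd X j m = 1 := by
  induction m generalizing j with
  | zero => simp
  | succ m ih =>
    rw [segmentProd_succ, star_mul, mul_assoc, ← mul_assoc (star (X j)), hX.star_eq, neg_mul,
      hX.mul_self, neg_neg, one_mul, ih]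

theorem star_segmentProd_mul_segmentProd (hX : IsFrustrationCycle n X) (i : ℕ) {j k : ℕ}
    (hjk : j ≤ k) :
    star (segmentProd X i j) * segmentProd X i k = segmentProd X (i + j) (k - j) := by
  obtain ⟨m, rfl⟩ := Nat.exists_eq_add_of_le hjk
  rw [segmentProd_add, ← mul_assoc, hX.star_segmentProd_mul_self, one_mul, Nat.add_sub_cancel_left]

theorem mul_segmentProd (hX : IsFrustrationCycle n X) (j : ℕ) {m : ℕ} (hm : 0 < m) (hmn : m < n) :
    X j * segmentProd X (j + 1) m = -(segmentProd X (j + 1) m * X j) := by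
  obtain ⟨m, rfl⟩ := Nat.exists_eq_add_one.2 hm
  have hrest : Commute (X j) (segmentProd X (j + 1 + 1) m) := by
    refine Commute.list_prod_right _ _ fun y hy => ?_
    obtain ⟨k, hk, rfl⟩ := List.mem_map.1 hy
    obtain ⟨hjk, hkm⟩ := List.mem_range'_1.1 hk
    obtain ⟨d, rfl⟩ := Nat.exists_eq_add_of_le (show j ≤ k by lia)
    exact hX.commute j d (by lia) (by lia)
  rw [segmentProd_succ, ← mul_assoc, hX.anticommute, neg_mul, mul_assoc, hrest.eq, mul_assoc]

theorem star_segmentProd (hX : IsFrustrationCycle n X) (j : ℕ) {m : ℕ} (hm : 0 < m)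
    (hmn : m ≤ n) : star (segmentProd X j m) = -segmentProd X j m := by
  induction m, hm using Nat.le_induction generalizing j with
  | base => rw [Nat.succ_eq_add_one, zero_add, segmentProd_one, hX.star_eq]
  | succ m hm ih =>
    rw [segmentProd_succ, star_mul, ih (j + 1) (by lia), hX.star_eq, neg_mul_neg,
      hX.mul_segmentProd j hm hmn, neg_neg]

theorem star_segmentProd_mul_eq_neg (hX : IsFrustrationCycle n X) (i : ℕ) {j k : ℕ} (hjk : j ≠ k)
    (hj : j ≤ n) (hk : k ≤ n) :
    star (segmentProd X i k) * segmentProd X i j =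
      -(star (segmentProd X i j) * segmentProd X i k) := by
  wlog hlt : j < k generalizing j k
  · rw [this hjk.symm hk hj (by lia), neg_neg]
  have hstar : star (segmentProd X i k) * segmentProd X i j =
      star (star (segmentProd X i j) * segmentProd X i k) := by rw [star_mul, star_star]
  rw [hstar, hX.star_segmentProd_mul_segmentProd i hlt.le,
    hX.star_segmentProd _ (by lia) (by lia)]

theorem commute_segmentProd (hX : IsFrustrationCycle n X) (hn : 2 ≤ n) (j : ℕ) :
    Commute (X j) (segmentProd X (j + 1) n) := by
  obtain ⟨n, rfl⟩ := Nat.exists_eq_add_of_le' (show 1 ≤ n by lia)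
  have hlast : X j * X (j + 1 + n) = -(X (j + 1 + n) * X j) := by
    have h := hX.anticommute (j + 1 + n)
    rw [show j + 1 + n + 1 = j + (n + 1 + 1) by ring, hX.periodic] at h
    rw [h, neg_neg]
  rw [Commute, SemiconjBy, segmentProd_add, segmentProd_one, ← mul_assoc,
    hX.mul_segmentProd j (by lia) (Nat.lt_succ_self n), neg_mul, mul_assoc, hlast, mul_neg, neg_neg,
    mul_assoc]

theorem segmentProd_full (hX : IsFrustrationCycle n X) (hn : 2 ≤ n) (j : ℕ) :
    segmentProd X j (n + 1) = segmentProd X 0 (n + 1) := by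
  induction j with
  | zero => rfl
  | succ j ih =>
    rw [← ih, segmentProd_succ j, (hX.commute_segmentProd hn j).eq, segmentProd_add,
      segmentProd_one, add_assoc, add_comm 1 n, hX.periodic]

theorem commute_segmentProd_full (hX : IsFrustrationCycle n X) (hn : 2 ≤ n) (j : ℕ) :
    Commute (X j) (segmentProd X 0 (n + 1)) := by
  rw [← hX.segmentProd_full hn j, segmentProd_succ]
  exact (Commute.refl _).mul_right (hX.commute_segmentProd hn j)

theorem star_segmentProd_full (hX : IsFrustrationCycle n X) (hn : 2 ≤ n) :
    star (segmentProd X 0 (n + 1)) = segmentProd X 0 (n + 1) := by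
  rw [segmentProd_succ, star_mul, hX.star_segmentProd _ (by lia) le_rfl, hX.star_eq, neg_mul_neg,
    (hX.commute_segmentProd hn 0).eq]

theorem mul_segmentProd_full (hX : IsFrustrationCycle n X) :
    X 0 * segmentProd X 0 (n + 1) = -segmentProd X 1 n := by
  rw [segmentProd_succ, ← mul_assoc, hX.mul_self, neg_one_mul]

variable [Algebra ℂ A] [StarModule ℂ A] {ω : A →ₗ[ℂ] ℂ}

theorem sum_norm_sq_add_norm_sq_le (hX : IsFrustrationCycle n X) (hn : 2 ≤ n) (hn' : Even n)
    (hω : IsPositiveFunctional ω) :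
    ∑ k : Fin n, ‖ω (X (k + 1))‖ ^ 2 + ‖ω (X 0 * segmentProd X 0 (n + 1))‖ ^ 2 ≤
      n / 2 * (ω 1).re ^ 2 := by
  have h := hω.sum_norm_sq_star_mul_add_one_le hn hn' (b := fun k => segmentProd X 1 k)
    (fun k => hX.star_segmentProd_mul_self 1 k)
    (fun j k hjk => hX.star_segmentProd_mul_eq_neg 1 (Fin.val_ne_of_ne hjk) (by lia) (by lia))
  have hstep : ∀ k : ℕ, star (segmentProd X 1 k) * segmentProd X 1 (k + 1) = X (k + 1) :=
    fun k => by
      rw [hX.star_segmentProd_mul_segmentProd 1 k.le_succ, Nat.succ_eq_add_one,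
        Nat.add_sub_cancel_left, segmentProd_one, add_comm]
  have hwrap : ‖ω (X 0 * segmentProd X 0 (n + 1))‖ = ‖ω (star (segmentProd X 1 n))‖ := by
    rw [hX.mul_segmentProd_full, hX.star_segmentProd 1 (by lia) le_rfl]
  rw [Fin.sum_univ_castSucc] at h
  simpa only [Fin.coeSucc_eq_succ, Fin.val_castSucc, Fin.val_succ, hstep, Fin.last_add_one,
    Fin.val_last, Fin.val_zero, segmentProd_zero, mul_one, ← hwrap] using h

theorem norm_toLp_le_of_norm_mul_eq (hX : IsFrustrationCycle n X) (hn : 2 ≤ n) (hn' : Even n)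
    (hω : IsPositiveFunctional ω) (hZ : ‖ω (X 0 * segmentProd X 0 (n + 1))‖ = ‖ω (X 0)‖) :
    ‖WithLp.toLp 2 fun k : Fin (n + 1) => ω (X k)‖ ≤ √(n / 2) * (ω 1).re := by
  refine le_of_sq_le_sq ?_ (mul_nonneg (Real.sqrt_nonneg _)
    (Complex.nonneg_iff.1 hω.map_one_nonneg).1)
  rw [mul_pow, Real.sq_sqrt (by positivity), EuclideanSpace.norm_sq_eq, Fin.sum_univ_succ, add_comm]
  simpa [hZ] using hX.sum_norm_sq_add_norm_sq_le hn hn' hω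

/-- The product `Z` of the whole cycle is a central involution; compressing to its two eigenspaces
turns `Z` into a sign. -/
theorem norm_toLp_le (hX : IsFrustrationCycle n X) (hn : 2 ≤ n) (hn' : Even n)
    (hω : IsPositiveFunctional ω) :
    ‖WithLp.toLp 2 fun k : Fin (n + 1) => ω (X k)‖ ≤ √(n / 2) * (ω 1).re := by
  set Z := segmentProd X 0 (n + 1) with hZdef
  have hZ : star Z = Z := hX.star_segmentProd_full hn
  have hZZ : Z * Z = 1 := by
    simpa only [← hZdef, hZ] using hX.star_segmentProd_mul_self 0 (n + 1)
  have hcomm : ∀ k, Commute (X k) Z := hX.commute_segmentProd_full hn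
  set p : A := (2⁻¹ : ℂ) • (1 + Z) with hp
  set q : A := (2⁻¹ : ℂ) • (1 - Z) with hq
  have hZp : Z * p = p := by rw [hp, mul_smul_comm, mul_add, hZZ, mul_one, add_comm]
  have hZq : Z * q = -q := by rw [hq, mul_smul_comm, mul_sub, hZZ, mul_one, ← smul_neg, neg_sub]
  have hsplit : ∀ x, Commute x Z → star p * (x * p) + star q * (x * q) = x := fun x hx => by
    have hx' : Z * (Z * x) = x := by rw [← mul_assoc, hZZ, one_mul]
    simp only [hp, hq, star_smul, star_add, star_sub, star_one, hZ, smul_mul_assoc, mul_smul_comm,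
      add_mul, sub_mul, mul_add, mul_sub, one_mul, mul_one, hx', hx.eq, Complex.star_def, map_inv₀,
      Complex.conj_ofNat]
    module
  have hωp := hX.norm_toLp_le_of_norm_mul_eq hn hn' (hω.compress p)
    (by simp [mul_assoc, ← hZdef, hZp])
  have hωq := hX.norm_toLp_le_of_norm_mul_eq hn hn' (hω.compress q)
    (by simp [mul_assoc, ← hZdef, hZq])
  have hsum : ∀ x, Commute x Z → ω x = ω (star p * (x * p)) + ω (star q * (x * q)) :=
    fun x hx => by rw [← map_add, hsplit x hx]
  simp only [hsum _ (hcomm _), hsum _ (Commute.one_left Z), Complex.add_re, mul_add]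
  exact (norm_add_le (WithLp.toLp 2 _) (WithLp.toLp 2 _)).trans (add_le_add hωp hωq)

end IsFrustrationCycle

end FrustrationCycle

section FrustrationFamily

variable {κ A : Type*} [Ring A] [StarRing A] {G : SimpleGraph κ} {S : κ → A}

/-- Self-adjoint involutions in a star ring that anticommute along the edges of `G` and commute
otherwise; Pauli strings realizing `G` are an instance. -/
structure IsFrustrationFamily (G : SimpleGraph κ) (S : κ → A) : Prop where
  star_eq : ∀ i, star (S i) = S i
  mul_self : ∀ i, S i * S i = 1
  anticommute : ∀ ⦃i j⦄, G.Adj i j → S i * S j = -(S j * S i)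
  commute : ∀ ⦃i j⦄, ¬ G.Adj i j → Commute (S i) (S j)

namespace IsFrustrationFamily

theorem comap {κ' : Type*} (hS : IsFrustrationFamily G S) (f : κ' → κ) :
    IsFrustrationFamily (G.comap f) (S ∘ f) where
  star_eq i := hS.star_eq (f i)
  mul_self i := hS.mul_self (f i)
  anticommute _ _ h := hS.anticommute h
  commute _ _ h := hS.commute h

variable [Algebra ℂ A]

theorem sum_smul_mul_self (hS : IsFrustrationFamily G S) {K : Finset κ}
    (hK : G.IsClique (K : Set κ)) (c : κ → ℂ) :
    (∑ i ∈ K, c i • S i) * ∑ i ∈ K, c i • S i = (∑ i ∈ K, c i ^ 2) • (1 : A) := by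
  classical
  set B := ∑ i ∈ K, c i • S i with hB
  have hBB : B * B = ∑ i ∈ K, ∑ j ∈ K, (c i * c j) • (S i * S j) := by
    simp only [hB, Finset.sum_mul_sum, smul_mul_smul_comm]
  have hBB' : B * B = ∑ i ∈ K, ∑ j ∈ K, (c i * c j) • (S j * S i) := by
    rw [hBB, Finset.sum_comm]
    simp only [mul_comm (c _) (c _)]
  have hdouble : (2 : ℂ) • (B * B) = (2 : ℂ) • (∑ i ∈ K, c i ^ 2) • (1 : A) := by
    rw [two_smul]
    nth_rw 1 [hBB]
    rw [hBB', ← Finset.sum_add_distrib, Finset.sum_smul, Finset.smul_sum]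
    refine Finset.sum_congr rfl fun i hi => ?_
    rw [← Finset.sum_add_distrib, Finset.sum_eq_single_of_mem i hi fun j hj hji => ?_]
    · rw [hS.mul_self]
      module
    · rw [hS.anticommute (hK hi hj hji.symm)]
      module
  exact smul_right_injective A (two_ne_zero (α := ℂ)) hdouble

variable [StarModule ℂ A] {ω : A →ₗ[ℂ] ℂ}

theorem sum_sq_re_le_one (hS : IsFrustrationFamily G S) (hω : IsPositiveFunctional ω)
    (hω1 : ω 1 = 1) {K : Finset κ} (hK : G.IsClique (K : Set κ)) :
    ∑ i ∈ K, (ω (S i)).re ^ 2 ≤ 1 := by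
  set s : ℝ := ∑ i ∈ K, (ω (S i)).re ^ 2 with hs
  set B : A := ∑ i ∈ K, ((ω (S i)).re : ℂ) • S i with hB
  have hBB : B * B = (s : ℂ) • 1 := by
    rw [hB, hS.sum_smul_mul_self hK, hs]
    push_cast
    rfl
  have hstar : star B = B := by simp [hB, star_sum, hS.star_eq]
  have hωB : ω B = s := by
    rw [hB, map_sum, hs, Complex.ofReal_sum]
    refine Finset.sum_congr rfl fun i _ => ?_
    rw [map_smul, smul_eq_mul, Complex.ofReal_pow, sq, hω.re_eq (hS.star_eq i)]
  have hvariance : ω (star (B - (s : ℂ) • 1) * (B - (s : ℂ) • 1)) = ((s - s ^ 2 : ℝ) : ℂ) := by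
    simp only [star_sub, hstar, star_smul, star_one, Complex.star_def, Complex.conj_ofReal, sub_mul,
      mul_sub, smul_mul_assoc, mul_smul_comm, one_mul, mul_one, hBB, map_sub, map_smul, hωB, hω1,
      smul_eq_mul]
    push_cast
    ring
  have hle : 0 ≤ s - s ^ 2 := Complex.zero_le_real.1 (hvariance ▸ hω _)
  by_contra! h
  nlinarith

variable {n : ℕ} {S : Fin (n + 1) → A}

theorem isFrustrationCycle (hS : IsFrustrationFamily (SimpleGraph.cycleGraph (n + 1)) S)
    (hn : 1 ≤ n) : IsFrustrationCycle n fun k => Complex.I • S (Fin.ofNat (n + 1) k) where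
  star_eq k := by simp [hS.star_eq]
  mul_self k := by
    rw [smul_mul_smul_comm, hS.mul_self, Complex.I_mul_I, neg_smul, one_smul]
  periodic k := by simp [Fin.ofNat]
  anticommute k := by
    have hadj : (SimpleGraph.cycleGraph (n + 1)).Adj (Fin.ofNat (n + 1) k)
        (Fin.ofNat (n + 1) (k + 1)) := by
      rw [cycleGraph_adj_iff hn]
      exact .inl (by simp [Fin.ext_iff, Fin.val_add])
    rw [smul_mul_smul_comm, smul_mul_smul_comm, hS.anticommute hadj, smul_neg]
  commute k d hd hdn := by
    refine Commute.smul_left (Commute.smul_right (hS.commute ?_) _) _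
    rw [cycleGraph_adj_iff hn]
    rintro (h | h)
    · have hmod : (k + d) % (n + 1) = (k + 1) % (n + 1) := by
        simpa [Fin.ext_iff, Fin.val_add] using h
      have := (Nat.ModEq.add_left_cancel' k hmod).eq_of_lt_of_lt (by lia) (by lia)
      lia
    · have hmod : (k + 0) % (n + 1) = (k + (d + 1)) % (n + 1) := by
        simpa [Fin.ext_iff, Fin.val_add, add_assoc] using h
      have := (Nat.ModEq.add_left_cancel' k hmod).eq_of_lt_of_lt (by lia) (by lia)
      lia

theorem sum_sq_re_le (hS : IsFrustrationFamily (SimpleGraph.cycleGraph (n + 1)) S)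
    (hn : 2 ≤ n) (hn' : Even n) (hω : IsPositiveFunctional ω) (hω1 : ω 1 = 1) :
    ∑ k, (ω (S k)).re ^ 2 ≤ n / 2 := by
  have h := (hS.isFrustrationCycle (by lia)).norm_toLp_le hn hn' hω
  rw [hω1, Complex.one_re, mul_one, Real.le_sqrt (norm_nonneg _) (by positivity),
    EuclideanSpace.norm_sq_eq] at h
  refine le_of_eq_of_le (Finset.sum_congr rfl fun k _ => ?_) h
  simp only [Fin.ofNat_val_eq_self]
  rw [map_smul, smul_eq_mul, norm_mul, Complex.norm_I, one_mul,
    ← hω.re_eq (hS.star_eq k), Complex.norm_real, Real.norm_eq_abs, sq_abs, Complex.ofReal_re]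

end IsFrustrationFamily

end FrustrationFamily

/-! ### Pauli strings -/

section Pauli

variable {m : ℕ}

theorem pauliMatrix_conjTranspose (p : PauliLabel) : (pauliMatrix p)ᴴ = pauliMatrix p := by
  cases p <;> ext i j <;> fin_cases i <;> fin_cases j <;> simp [pauliMatrix]

theorem pauliString_conjTranspose (p : Fin m → PauliLabel) : (pauliString p)ᴴ = pauliString p := by
  ext x y
  simp only [Matrix.conjTranspose_apply, pauliString, Matrix.of_apply, star_prod]
  exact Finset.prod_congr rfl fun k _ => by
    rw [← Matrix.conjTranspose_apply, pauliMatrix_conjTranspose]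

theorem exists_pauliMatrix_mul_eq_units_smul (p q : PauliLabel) :
    ∃ ε : ℤˣ, pauliMatrix p * pauliMatrix q = ε • (pauliMatrix q * pauliMatrix p) := by
  have h : pauliMatrix p * pauliMatrix q = pauliMatrix q * pauliMatrix p ∨
      pauliMatrix p * pauliMatrix q = -(pauliMatrix q * pauliMatrix p) := by
    cases p <;> cases q <;>
      first
      | left; ext i j; fin_cases i <;> fin_cases j <;> simp [pauliMatrix]; done
      | right; ext i j; fin_cases i <;> fin_cases j <;> simp [pauliMatrix]
  rcases h with h | h
  · exact ⟨1, by rw [h, one_smul]⟩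
  · exact ⟨-1, by rw [h, Units.neg_smul, one_smul]⟩

theorem pauliString_commute_or_anticommute (p q : Fin m → PauliLabel) :
    Commute (pauliString p) (pauliString q) ∨
      pauliString p * pauliString q = -(pauliString q * pauliString p) := by
  choose ε hε using fun k => exists_pauliMatrix_mul_eq_units_smul (p k) (q k)
  have h : pauliString p * pauliString q = (∏ k, ε k) • (pauliString q * pauliString p) := by
    ext x y
    rw [Matrix.smul_apply, pauliString_mul_apply, pauliString_mul_apply]
    simp only [hε, Matrix.smul_apply, Finset.prod_smul]
  rcases Int.units_eq_one_or (∏ k, ε k) with hsign | hsign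
  · exact .inl (by rw [Commute, SemiconjBy, h, hsign, one_smul])
  · exact .inr (by rw [h, hsign, Units.neg_smul, one_smul])

theorem IsRealization.isFrustrationFamily {V : Type*} {G : SimpleGraph V}
    {S : V → Fin m → PauliLabel} (hS : IsRealization G S) :
    IsFrustrationFamily G fun i => pauliString (S i) where
  star_eq i := pauliString_conjTranspose (S i)
  mul_self i := pauliString_mul_self (S i)
  anticommute i j h := (hS i j).1 h
  commute i j h := (pauliString_commute_or_anticommute (S i) (S j)).resolve_right
    fun h' => h ((hS i j).2 h')

end Pauli

section State

variable {ι κ : Type*} [Fintype ι]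

theorem exists_isState_forall_expectation_eq {v : ι → ℂ} (hv : v ≠ 0) :
    ∃ ρ, IsState ρ ∧ ∀ (A : Matrix ι ι ℂ) (ε : ℝ), A *ᵥ v = ε • v → expectation A ρ = ε := by
  set n : ℂ := v ⬝ᵥ star v with hn
  have hn0 : 0 < n := Matrix.dotProduct_self_star_pos_iff.2 hv
  refine ⟨n⁻¹ • Matrix.vecMulVec v (star v),
    ⟨(Matrix.posSemidef_vecMulVec_self_star v).smul (inv_nonneg.2 hn0.le), ?_⟩, fun A ε h => ?_⟩
  · rw [Matrix.trace_smul, Matrix.trace_vecMulVec, smul_eq_mul, ← hn, inv_mul_cancel₀ hn0.ne']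
  · rw [expectation, Matrix.trace_mul_comm, Matrix.mul_smul, Matrix.mul_vecMulVec, h,
      Matrix.trace_smul, Matrix.trace_vecMulVec, smul_dotProduct, ← hn, smul_comm, smul_eq_mul,
      inv_mul_cancel₀ hn0.ne']
    simp

/-- The functional `A ↦ tr ρ A` attached to a density matrix; its real part is `expectation`. -/
noncomputable def stateFunctional (ρ : Matrix ι ι ℂ) : Matrix ι ι ℂ →ₗ[ℂ] ℂ :=
  Matrix.traceLinearMap ι ℂ ℂ ∘ₗ LinearMap.mulLeft ℂ ρ

variable [DecidableEq ι]

theorem IsState.isPositiveFunctional {ρ : Matrix ι ι ℂ} (hρ : IsState ρ) :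
    IsPositiveFunctional (stateFunctional ρ) := fun A => by
  change 0 ≤ (ρ * (Aᴴ * A)).trace
  rw [← mul_assoc, Matrix.trace_mul_comm, ← mul_assoc]
  exact (hρ.1.mul_mul_conjTranspose_same A).trace_nonneg

theorem IsState.stateFunctional_one {ρ : Matrix ι ι ℂ} (hρ : IsState ρ) :
    stateFunctional ρ 1 = 1 := by
  simp [stateFunctional, hρ.2]

theorem exists_common_eigenvector [Nonempty ι] {S : κ → Matrix ι ι ℂ} (hSS : ∀ i, S i * S i = 1)
    (I : Finset κ) (hcomm : ∀ i ∈ I, ∀ j ∈ I, Commute (S i) (S j)) :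
    ∃ v : ι → ℂ, v ≠ 0 ∧ ∀ i ∈ I, S i *ᵥ v = v ∨ S i *ᵥ v = -v := by
  classical
  induction I using Finset.induction_on with
  | empty => exact ⟨1, one_ne_zero, by simp⟩
  | insert i I _ ih =>
    rw [Finset.forall_mem_insert] at hcomm
    obtain ⟨v, hv, hvI⟩ := ih fun j hj k hk => hcomm.2 j hj k (Finset.mem_insert_of_mem hk)
    by_cases h : v + S i *ᵥ v = 0
    · exact ⟨v, hv, Finset.forall_mem_insert _ _ _ |>.2 ⟨.inr (eq_neg_of_add_eq_zero_right h), hvI⟩⟩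
    · refine ⟨v + S i *ᵥ v, h, Finset.forall_mem_insert _ _ _ |>.2 ⟨.inl ?_, fun j hj => ?_⟩⟩
      · rw [Matrix.mulVec_add, Matrix.mulVec_mulVec, hSS, Matrix.one_mulVec, add_comm]
      · rw [Matrix.mulVec_add, Matrix.mulVec_mulVec,
          (hcomm.2 j hj i (Finset.mem_insert_self _ _)).eq, ← Matrix.mulVec_mulVec]
        exact (hvI j hj).imp (fun h' => by rw [h'])
          fun h' => by rw [h', Matrix.mulVec_neg, ← neg_add]

theorem IsFrustrationFamily.exists_isState [Nonempty ι] {G : SimpleGraph κ}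
    {S : κ → Matrix ι ι ℂ} (hS : IsFrustrationFamily G S) {I : Finset κ}
    (hI : G.IsIndepSet (I : Set κ)) :
    ∃ ρ, IsState ρ ∧ ∀ i ∈ I, expectation (S i) ρ ^ 2 = 1 := by
  obtain ⟨v, hv, hvI⟩ := exists_common_eigenvector hS.mul_self I fun i hi j hj =>
    hS.commute fun h => hI hi hj h.ne h
  obtain ⟨ρ, hρ, hexp⟩ := exists_isState_forall_expectation_eq hv
  refine ⟨ρ, hρ, fun i hi => ?_⟩
  rcases hvI i hi with h | h
  · simp [hexp (S i) 1 (by simpa using h)]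
  · simp [hexp (S i) (-1) (by simpa using h)]

end State

/-! ### `h`-perfect graphs are `ħ`-perfect -/

section Chords

variable {V : Type*} {G : SimpleGraph V} {a : ℕ} {f : Fin (2 * a + 1) → V}

theorem isOddClosedWalk_of_nat {p : ℕ → V} (hstep : ∀ k, G.Adj (p k) (p (k + 1)))
    (hclose : G.Adj (p (2 * a)) (p 0)) : IsOddClosedWalk G a fun k => p k := by
  intro k
  induction k using Fin.lastCases with
  | last => simpa using hclose
  | cast k => simpa [Fin.coeSucc_eq_succ] using hstep k

theorem IsOddClosedWalk.pos (hf : IsOddClosedWalk G a f) : 1 ≤ a := by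
  rw [Nat.one_le_iff_ne_zero]
  rintro rfl
  exact (hf 0).ne rfl

theorem IsOddClosedWalk.exists_chord (hf : IsOddClosedWalk G a f)
    (hne : G.comap f ≠ SimpleGraph.cycleGraph (2 * a + 1)) :
    ∃ s t : Fin (2 * a + 1), Even (t : ℕ) ∧ (t : ℕ) < 2 * a ∧ G.Adj (f (s + t)) (f s) := by
  have ha := hf.pos
  obtain ⟨j, k, hadj, hnot⟩ : ∃ j k, G.Adj (f j) (f k) ∧
      ¬(SimpleGraph.cycleGraph (2 * a + 1)).Adj j k := by
    by_contra! hsub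
    refine hne (le_antisymm (fun j k h => hsub j k h) fun j k h => ?_)
    rcases (cycleGraph_adj_iff (by lia)).1 h with rfl | rfl
    · exact hf j
    · exact (hf k).symm
  have hsub : k - j ≠ 0 := fun h => hadj.ne (congrArg f (sub_eq_zero.1 h).symm)
  wlog heven : Even (k - j).val generalizing j k
  · refine this k j hadj.symm (fun h => hnot h.symm) (sub_ne_zero.2 (sub_ne_zero.1 hsub).symm) ?_
    have hneg : (j - k).val = 2 * a + 1 - (k - j).val := by
      rw [← neg_sub, Fin.val_neg, if_neg hsub]
    grind
  refine ⟨j, k - j, heven, ?_, by simpa using hadj.symm⟩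
  by_contra! hlast
  have hneg : k - j = -1 := by
    rw [Fin.ext_iff, Fin.coe_neg_one]
    exact (Nat.lt_succ_iff.1 (k - j).isLt).antisymm hlast
  exact hnot ((cycleGraph_adj_iff (by lia)).2
    (.inr (sub_eq_iff_eq_add'.1 (neg_injective (by rw [neg_sub, hneg])))))

theorem sum_range_two_mul_le {y : ℕ → ℝ} (hy : ∀ k, y k + y (k + 1) ≤ 1) (n : ℕ) :
    ∑ k ∈ Finset.range (2 * n), y k ≤ n := by
  induction n with
  | zero => simp
  | succ n ih =>
    rw [show 2 * (n + 1) = 2 * n + 1 + 1 by ring, Finset.sum_range_succ, Finset.sum_range_succ]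
    push_cast
    linarith [hy (2 * n)]

/-- A chord cuts an odd closed walk into a shorter odd closed walk and a path with an even number
of vertices, on which the edge inequalities can be added up. -/
theorem IsOddClosedWalk.sum_le {x : V → ℝ} (hedge : ∀ i j, G.Adj i j → x i + x j ≤ 1)
    (hinduced : ∀ (b : ℕ) (g : Fin (2 * b + 1) → V), 1 ≤ b →
      G.comap g = SimpleGraph.cycleGraph (2 * b + 1) → ∑ k, x (g k) ≤ b)
    (hf : IsOddClosedWalk G a f) : ∑ k, x (f k) ≤ a := by
  induction a using Nat.strong_induction_on with
  | _ a ih =>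
  by_cases hcomap : G.comap f = SimpleGraph.cycleGraph (2 * a + 1)
  · exact hinduced a f hf.pos hcomap
  obtain ⟨s, t, ⟨d, ht⟩, hta, hchord⟩ := hf.exists_chord hcomap
  set p : ℕ → V := fun k => f (s + Fin.ofNat (2 * a + 1) k) with hp
  have hstep : ∀ k, G.Adj (p k) (p (k + 1)) := fun k => by
    have hsucc : Fin.ofNat (2 * a + 1) (k + 1) = Fin.ofNat (2 * a + 1) k + 1 := by
      simp [Fin.ext_iff, Fin.val_add]
    simpa only [hp, hsucc, add_assoc] using hf (s + Fin.ofNat (2 * a + 1) k)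
  have hclose : G.Adj (p (2 * d)) (p 0) := by
    simpa [hp, two_mul, ← ht] using hchord
  have hda : d < a := by lia
  have hrotate : ∑ k, x (f k) = ∑ k ∈ Finset.range (2 * a + 1), x (p k) := by
    rw [← Equiv.sum_comp (Equiv.addLeft s), ← Fin.sum_univ_eq_sum_range]
    simp [hp]
  have hwalk := ih d hda (f := fun k => p k)
    (isOddClosedWalk_of_nat hstep hclose)
  have hpath := sum_range_two_mul_le (y := fun k => x (p (2 * d + 1 + k)))
    (fun k => hedge _ _ (hstep _)) (a - d)
  rw [Fin.sum_univ_eq_sum_range (fun k => x (p k))] at hwalk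
  rw [hrotate, show 2 * a + 1 = (2 * d + 1) + 2 * (a - d) by lia, Finset.sum_range_add]
  rw [Nat.cast_sub hda.le] at hpath
  linarith

end Chords

section Hbar

variable {V : Type*} {G : SimpleGraph V}

section

variable {ι : Type*} [Fintype ι] [DecidableEq ι] {S : V → Matrix ι ι ℂ} {ρ : Matrix ι ι ℂ}

theorem IsFrustrationFamily.sum_sq_expectation_oddClosedWalk_le (hS : IsFrustrationFamily G S)
    (hρ : IsState ρ) {a : ℕ} {f : Fin (2 * a + 1) → V} (hf : IsOddClosedWalk G a f) :
    ∑ k, expectation (S (f k)) ρ ^ 2 ≤ a := by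
  classical
  refine hf.sum_le (x := fun i => expectation (S i) ρ ^ 2) (fun i j hij => ?_)
    fun b g hb hg => ?_
  · have hclique : G.IsClique (({i, j} : Finset V) : Set V) := by
      rw [Finset.coe_pair, SimpleGraph.isClique_pair]
      exact fun _ => hij
    have hedge := hS.sum_sq_re_le_one hρ.isPositiveFunctional hρ.stateFunctional_one hclique
    rw [Finset.sum_pair hij.ne] at hedge
    exact hedge
  · have hcycle := (hg ▸ hS.comap g).sum_sq_re_le (by lia) (even_two_mul b)
      hρ.isPositiveFunctional hρ.stateFunctional_one
    rwa [Nat.cast_mul, Nat.cast_two, mul_div_cancel_left₀ _ two_ne_zero] at hcycle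

theorem IsFrustrationFamily.sq_expectation_mem_hstab (hS : IsFrustrationFamily G S)
    (hρ : IsState ρ) : (fun i => expectation (S i) ρ ^ 2) ∈ hstab G := by
  refine ⟨fun i => sq_nonneg _, fun s b h => ?_⟩
  cases h with
  | clique hK =>
    rw [Nat.cast_one]
    exact hS.sum_sq_re_le_one hρ.isPositiveFunctional hρ.stateFunctional_one hK
  | oddCycle hC =>
    obtain ⟨f, hf, hinj, hrange⟩ := hC.exists_isOddClosedWalk
    rw [sum_eq_sum_of_range_eq hinj hrange]
    exact hS.sum_sq_expectation_oddClosedWalk_le hρ hf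

end

variable {m : ℕ} {S : V → Fin m → PauliLabel}

theorem IsRealization.varianceRange_subset_hstab (hS : IsRealization G S) :
    varianceRange S ⊆ hstab G := by
  rintro _ ⟨ρ, hρ, rfl⟩
  exact hS.isFrustrationFamily.sq_expectation_mem_hstab hρ

theorem IsRealization.betaBody_subset_hstab (hS : IsRealization G S) : betaBody S ⊆ hstab G := by
  refine fun x hx => ⟨hx.2, fun s b h => ?_⟩
  rw [← coordSum_apply]
  refine le_of_mem_convexHull (l := (coordSum s).toLinearMap) (fun u hu => ?_) hx.1
  obtain ⟨v, hv, huv⟩ := mem_lowerClosure.1 hu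
  calc coordSum s u = ∑ i ∈ s, u i := coordSum_apply s u
    _ ≤ ∑ i ∈ s, v i := Finset.sum_le_sum fun i _ => huv i
    _ ≤ b := (hS.varianceRange_subset_hstab hv).2 s b h

theorem IsRealization.stab_subset_betaBody [Finite V] (hS : IsRealization G S) :
    stab G ⊆ betaBody S := by
  classical
  have := Fintype.ofFinite V
  refine fun x hx => ⟨?_, nonneg_of_mem_stab hx⟩
  rw [stab_eq_convexHull_indicator] at hx
  refine convexHull_mono ?_ hx
  rintro _ ⟨I, hI, rfl⟩
  obtain ⟨ρ, hρ, hone⟩ :=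
    hS.isFrustrationFamily.exists_isState (I := I.toFinset) (by simpa using hI)
  refine mem_lowerClosure.2 ⟨_, ⟨ρ, hρ, rfl⟩, fun i => ?_⟩
  by_cases hi : i ∈ I
  · simp [hi, hone i (by simpa using hi)]
  · simpa [hi] using sq_nonneg _

theorem indepNumber_le_iff [Finite V] {w : V → ℝ} {c : ℝ} :
    indepNumber G w ≤ c ↔ ∀ s : Finset V, G.IsIndepSet (s : Set V) → ∑ i ∈ s, w i ≤ c := by
  have hfin : {r | ∃ s : Finset V, G.IsIndepSet (s : Set V) ∧ r = ∑ i ∈ s, w i}.Finite := by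
    refine (Set.finite_range fun s : Finset V => ∑ i ∈ s, w i).subset ?_
    rintro _ ⟨s, -, rfl⟩
    exact ⟨s, rfl⟩
  rw [indepNumber, csSup_le_iff hfin.bddAbove ⟨_, ∅, by simp, rfl⟩]
  exact ⟨fun h s hs => h _ ⟨s, hs, rfl⟩, by rintro h _ ⟨s, hs, rfl⟩; exact h s hs⟩

variable [Fintype V]

theorem sum_mul_le_indepNumber {x : V → ℝ} (hx : x ∈ stab G) (w : V → ℝ) :
    ∑ i, w i * x i ≤ indepNumber G w := by
  classical
  have hle := le_of_mem_stab (l := ∑ i, w i • LinearMap.proj i) (c := indepNumber G w)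
    (fun I hI => ?_) hx
  · simpa using hle
  · have h := indepNumber_le_iff.1 (le_refl (indepNumber G w)) {i | i ∈ I} (by simpa using hI)
    simpa [Set.indicator_apply, ← Finset.sum_filter] using h

theorem IsRealization.indepNumber_le_betaNumber (hS : IsRealization G S) {w : V → ℝ}
    (hw : ∀ i, 0 ≤ w i)
    (hbdd : BddAbove {r | ∃ ρ, IsState ρ ∧ r = ∑ i, w i * expectation (pauliString (S i)) ρ ^ 2}) :
    indepNumber G w ≤ betaNumber S w := by
  refine indepNumber_le_iff.2 fun s hs => ?_
  obtain ⟨ρ, hρ, hone⟩ := hS.isFrustrationFamily.exists_isState hs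
  calc ∑ i ∈ s, w i = ∑ i ∈ s, w i * expectation (pauliString (S i)) ρ ^ 2 :=
        Finset.sum_congr rfl fun i hi => by rw [hone i hi, mul_one]
    _ ≤ ∑ i, w i * expectation (pauliString (S i)) ρ ^ 2 :=
        Finset.sum_le_sum_of_subset_of_nonneg (Finset.subset_univ s)
          fun i _ _ => mul_nonneg (hw i) (sq_nonneg _)
    _ ≤ betaNumber S w := le_csSup hbdd ⟨ρ, hρ, rfl⟩

theorem IsHPerfect.isHbarPerfect (hG : IsHPerfect G) : IsHbarPerfect G := by
  intro m S hS
  refine ⟨hS.stab_subset_betaBody.antisymm (hS.betaBody_subset_hstab.trans hG.hstab_subset_stab),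
    fun w hw => ?_⟩
  have hle : ∀ r ∈ {r | ∃ ρ, IsState ρ ∧ r = ∑ i, w i * expectation (pauliString (S i)) ρ ^ 2},
      r ≤ indepNumber G w := by
    rintro _ ⟨ρ, hρ, rfl⟩
    exact sum_mul_le_indepNumber
      (hG.hstab_subset_stab (hS.varianceRange_subset_hstab ⟨ρ, hρ, rfl⟩)) w
  refine (csSup_le ?_ hle).antisymm (hS.indepNumber_le_betaNumber hw ⟨_, hle⟩)
  obtain ⟨ρ, hρ, -⟩ := hS.isFrustrationFamily.exists_isState (I := ∅) (by simp)
  exact ⟨_, ρ, hρ, rfl⟩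

end Hbar

end HbarGraph

theorem theorem2 {V : Type*} [Fintype V] (G : SimpleGraph V) :
    (HbarGraph.IsPerfect G → HbarGraph.IsHPerfect G) ∧
    (HbarGraph.IsHPerfect G → HbarGraph.IsHbarPerfect G) ∧
    (∀ a : ℕ, 1 ≤ a → HbarGraph.IsHPerfect (SimpleGraph.cycleGraph (2 * a + 1))) :=
  ⟨HbarGraph.IsPerfect.isHPerfect, HbarGraph.IsHPerfect.isHbarPerfect,
    fun _ => HbarGraph.isHPerfect_cycleGraph⟩
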